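/- Let $(X,d)$ be a complete separable metric space and let $E:X\to\mathbb{R}\cup\{+\infty\}$ be lower semicontinuous, with dense domain $D(E)=\{E<\infty\}$, and bounded from below on every $d$-bounded set. Let $\lambda\in\mathbb{R}$ and assume that for every $x\in X$ there exists an $\mathrm{EVI}_\lambda$-gradient flow of $E$ starting at $x$, that is, a curve $u\in AC_{loc}((0,\infty),X)$ with $u_t\to x$ as $t\downarrow 0$ such that, for every $y\in X$ and for a.e. $t>0$, \[ \frac12\frac{d}{dt}d^2(u_t,y)+\frac{\lambda}{2}d^2(u_t,y)+E(u_t)\le E(y). \] Such a flow is unique; write $S_tx:=u_t$ for $t>0$ and $S_0x:=x$. Let $|\partial E|(x):=\limsup_{y\to x}\frac{[E(x)-E(y)]^+}{d(x,y)}$ for $x\in D(E)$ ($0$ if $x$ is isolated), and $|\partial E|(x):=+\infty$ for $x\notin D(E)$. For a curve $\gamma$ in $X$ denote by $|\dot\gamma_t|:=\lim_{s\to t}\frac{d(\gamma_s,\gamma_t)}{|s-t|}$ its metric speed. Let $\gamma:[0,1]\to X$ be an absolutely continuous curve, let $h:[0,1]\to\mathbb{R}$ be absolutely continuous with $h(t)>0$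 for all $t\in(0,1)$, and set $\tilde\gamma_t:=S_{h(t)}\gamma_t$ for $t\in[0,1]$. Then $E(\tilde\gamma_t)<\infty$ and $|\partial E|(\tilde\gamma_t)<\infty$ for all $t\in(0,1)$, and for a.e. $t\in(0,1)$ the metric speeds $|\dot\gamma_t|$ and $|\dot{\tilde\gamma}_t|$ and the derivatives $h'(t)$ and $\frac{d}{dt}E(\tilde\gamma_t)$ exist (and are finite) and satisfy \[ \frac12|\dot{\tilde\gamma}_t|^2+\frac12|h'(t)|^2\,|\partial E|^2(\tilde\gamma_t)+h'(t)\,\frac{d}{dt}E(\tilde\gamma_t)\le\frac12 e^{-2\lambda h(t)}|\dot\gamma_t|^2 . \] -/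

import Mathlib

open Set Filter Topology MeasureTheory

/-- `γ` has metric speed `v` at time `t`: `v = lim_{s → t} d(γ_s, γ_t) / |s - t|`. -/
def HasMetricSpeedAt {X : Type*} [MetricSpace X] (γ : ℝ → X) (v t : ℝ) : Prop :=
  Tendsto (fun s : ℝ => dist (γ s) (γ t) / |s - t|) (𝓝[≠] t) (𝓝 v)

open Classical in
/-- The (descending) metric slope `|∂E|(x) ∈ [0, ∞]`: it is `∞` where `E = +∞`, and
`limsup_{y → x, y ≠ x} [E(x) - E(y)]⁺ / d(x, y)` elsewhere. At an isolated point of the domain the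
limsup is along the trivial filter and equals `0`, see `descendingSlope_of_isolated`. -/
noncomputable def descendingSlope {X : Type*} [MetricSpace X] (E : X → EReal) (x : X) : ENNReal :=
  if E x = ⊤ then ⊤
  else limsup (fun y => (E x - E y).toENNReal / edist x y) (𝓝[≠] x)

theorem descendingSlope_of_isolated {X : Type*} [MetricSpace X] (E : X → EReal) (x : X)
    (hx : E x ≠ ⊤) (hiso : 𝓝[≠] x = ⊥) : descendingSlope E x = 0 := by
  simp [descendingSlope, hx, hiso]

/-- `u` (only its values at times `t > 0` matter) is a gradient flow of `E` in the `EVI_lam` sense: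
`u ∈ AC_loc((0, ∞), X)`, and for every `y`, for almost every `t > 0`,
`½ d/dt d²(u_t, y) + lam/2 d²(u_t, y) + E(u_t) ≤ E(y)`. -/
structure IsEVIFlow {X : Type*} [MetricSpace X] (E : X → EReal) (lam : ℝ) (u : ℝ → X) : Prop where
  ac_loc : ∀ a b : ℝ, 0 < a → a ≤ b → AbsolutelyContinuousOnInterval u a b
  evi : ∀ y : X, ∀ᵐ t : ℝ, 0 < t → ∃ D : ℝ, HasDerivAt (fun s => dist (u s) y ^ 2) D t ∧
    ((1 / 2 * D + lam / 2 * dist (u t) y ^ 2 : ℝ) : EReal) + E (u t) ≤ E y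

/-- `u` is an `EVI_lam` gradient flow of `E` that starts at `x ∈ closure D(E)`. -/
structure IsEVIFlowFrom {X : Type*} [MetricSpace X] (E : X → EReal) (lam : ℝ) (u : ℝ → X)
    (x : X) : Prop where
  flow : IsEVIFlow E lam u
  mem_closure : x ∈ closure {z | E z ≠ ⊤}
  tendsto_start : Tendsto u (𝓝[>] 0) (𝓝 x)

open Classical in
/-- `S_t x`: the value at time `t > 0` of the `EVI_lam` gradient flow of `E` starting at `x`, and
`S_0 x = x`. There is at most one such flow, so that the choice is immaterial; the value is `x`
where no flow starts, and for `t < 0`. -/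
noncomputable def eviSemigroup {X : Type*} [MetricSpace X] (E : X → EReal) (lam : ℝ)
    (t : ℝ) (x : X) : X :=
  if hx : ∃ u : ℝ → X, IsEVIFlowFrom E lam u x then
    if 0 < t then hx.choose t else x
  else x

/-- The standing assumptions on `E : X → ℝ ∪ {+∞}`: lower semicontinuous, with dense domain,
bounded from below on bounded sets, and every point is the start of an `EVI_lam` gradient flow. -/
structure EVISetting {X : Type*} [MetricSpace X] (E : X → EReal) (lam : ℝ) : Prop where
  ne_bot : ∀ x, E x ≠ ⊥
  lsc : LowerSemicontinuous E
  dense_domain : Dense {x | E x ≠ ⊤}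
  bddBelow : ∀ B : Set X, Bornology.IsBounded B → ∃ c : ℝ, ∀ x ∈ B, (c : EReal) ≤ E x
  exists_flow : ∀ x : X, ∃ u : ℝ → X, IsEVIFlowFrom E lam u x

/-!
Write `Γ_t = S_{h(t)} γ_t`. If `h(s) > h(t)`, then `Γ_s` is reached from `S_{h(t)} γ_s` by letting
the flow run for the further time `h(s) - h(t)`. The contraction estimate
`d(S_r x, S_r y) ≤ e^{-λ r} d(x, y)` controls the distance of `S_{h(t)} γ_s` to `Γ_t`, and the EVI,
tested with `Γ_t` and integrated over `[h(t), h(s)]`, the growth of this distance along the flow.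
The gain of `|∂E|²` comes from the energy: lower semicontinuity forces slopes close to `Γ_t` to be
at least any given `c < |∂E|(Γ_t)`, hence `E` decreases along the flow at rate at least `c²` on
this interval. Dividing by `(s - t)²` and letting `s → t` and `c → |∂E|(Γ_t)` gives the inequality,
when `s` tends to `t` from the side on which `h(s) > h(t)`. Such a side exists unless `h'(t) = 0`;
in that case the speed of `Γ` is bounded by contraction alone, since flows are locally Lipschitz in
time.
-/

section AbsolutelyContinuous

variable {X Y Z : Type*} [PseudoMetricSpace X] [PseudoMetricSpace Y] [PseudoMetricSpace Z]
  {a b : ℝ}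

theorem absolutelyContinuousOnInterval_of_dist_le {f : ℝ → X} {g : ℝ → Y} {k : ℝ → Z} (K L : ℝ)
    (hg : AbsolutelyContinuousOnInterval g a b) (hk : AbsolutelyContinuousOnInterval k a b)
    (hf : ∀ s ∈ uIcc a b, ∀ t ∈ uIcc a b,
      dist (f s) (f t) ≤ K * dist (g s) (g t) + L * dist (k s) (k t)) :
    AbsolutelyContinuousOnInterval f a b := by
  have hlim := (Tendsto.const_mul K hg).add (Tendsto.const_mul L hk)
  rw [mul_zero, mul_zero, add_zero] at hlim
  refine squeeze_zero' (Eventually.of_forall fun _ => Finset.sum_nonneg fun _ _ => dist_nonneg)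
    (eventually_inf_principal.2 (Eventually.of_forall fun I hI => ?_)) hlim
  rw [Finset.mul_sum, Finset.mul_sum, ← Finset.sum_add_distrib]
  exact Finset.sum_le_sum fun i hi => hf _ (hI.1 i hi).1 _ (hI.1 i hi).2

theorem absolutelyContinuousOnInterval_dist {u v : ℝ → X}
    (hu : AbsolutelyContinuousOnInterval u a b) (hv : AbsolutelyContinuousOnInterval v a b) :
    AbsolutelyContinuousOnInterval (fun t => dist (u t) (v t)) a b :=
  absolutelyContinuousOnInterval_of_dist_le 1 1 hu hv fun s _ t _ => by
    simpa only [one_mul] using dist_dist_dist_le (u s) (v s) (u t) (v t)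

theorem absolutelyContinuousOnInterval_const (x : X) :
    AbsolutelyContinuousOnInterval (fun _ => x) a b :=
  LipschitzOnWith.absolutelyContinuousOnInterval (K := 0) (LipschitzWith.const x).lipschitzOnWith

theorem absolutelyContinuousOnInterval_id : AbsolutelyContinuousOnInterval (fun t : ℝ => t) a b :=
  LipschitzWith.id.lipschitzOnWith.absolutelyContinuousOnInterval

theorem absolutelyContinuousOnInterval_dist_const {u : ℝ → X}
    (hu : AbsolutelyContinuousOnInterval u a b) (y : X) :
    AbsolutelyContinuousOnInterval (fun t => dist (u t) y) a b :=
  absolutelyContinuousOnInterval_dist hu (absolutelyContinuousOnInterval_const y)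

theorem continuousOn_of_absolutelyContinuousOnInterval {u : ℝ → X}
    (hu : AbsolutelyContinuousOnInterval u a b) : ContinuousOn u (uIcc a b) := fun t ht => by
  have hdist := (absolutelyContinuousOnInterval_dist_const hu (u t)).continuousOn t ht
  rw [ContinuousWithinAt, dist_self] at hdist
  exact tendsto_iff_dist_tendsto_zero.2 hdist

theorem absolutelyContinuousOnInterval_comp_add_right {f : ℝ → X} (τ : ℝ)
    (hf : AbsolutelyContinuousOnInterval f (a + τ) (b + τ)) :
    AbsolutelyContinuousOnInterval (fun t => f (t + τ)) a b := by
  have mem_uIcc_add : ∀ t ∈ uIcc a b, t + τ ∈ uIcc (a + τ) (b + τ) := fun t ht =>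
    image_add_const_uIcc τ a b ▸ mem_image_of_mem _ ht
  have mem_uIoc_sub : ∀ x y z : ℝ, z ∈ uIoc (x + τ) (y + τ) → z - τ ∈ uIoc x y := fun x y z hz => by
    rw [mem_uIoc] at hz ⊢
    exact hz.imp (fun h => ⟨by linarith, by linarith⟩) fun h => ⟨by linarith, by linarith⟩
  rw [absolutelyContinuousOnInterval_iff] at hf ⊢
  intro ε hε
  obtain ⟨δ, hδ, hsmall⟩ := hf ε hε
  refine ⟨δ, hδ, fun I hI hlen => ?_⟩
  refine hsmall (I.1, fun i => ((I.2 i).1 + τ, (I.2 i).2 + τ))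
    ⟨fun i hi => ⟨mem_uIcc_add _ (hI.1 i hi).1, mem_uIcc_add _ (hI.1 i hi).2⟩, ?_⟩
    (by simpa only [dist_add_right] using hlen)
  intro i hi j hj hij
  refine Set.disjoint_left.2 fun z hzi hzj => ?_
  exact Set.disjoint_left.1 (hI.2 hi hj hij) (mem_uIoc_sub _ _ _ hzi) (mem_uIoc_sub _ _ _ hzj)

theorem le_of_ae_deriv_nonpos {f : ℝ → ℝ} (hab : a ≤ b) (hf : AbsolutelyContinuousOnInterval f a b)
    (hderiv : ∀ᵐ t : ℝ, t ∈ Ioo a b → deriv f t ≤ 0) : f b ≤ f a := by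
  rw [← sub_nonpos, ← hf.integral_deriv_eq_sub, intervalIntegral.integral_of_le hab,
    integral_Ioc_eq_integral_Ioo]
  exact setIntegral_nonpos_of_ae_restrict ((ae_restrict_iff' measurableSet_Ioo).2 hderiv)

end AbsolutelyContinuous

theorem tendsto_abs_sub_div_abs_sub {f : ℝ → ℝ} {D t : ℝ} (hf : HasDerivAt f D t) :
    Tendsto (fun s => |f s - f t| / |s - t|) (𝓝[≠] t) (𝓝 |D|) :=
  (hasDerivAt_iff_tendsto_slope.1 hf).abs.congr fun s => by rw [slope_def_field, abs_div]

theorem ae_mem_Ioo_of_forall_compact_subinterval {a b : ℝ} {P : ℝ → Prop}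
    (hP : ∀ c d, a < c → c < d → d < b → ∀ᵐ t : ℝ, t ∈ Ioo c d → P t) :
    ∀ᵐ t : ℝ, t ∈ Ioo a b → P t := by
  have hrat : ∀ᵐ t : ℝ, ∀ c d : ℚ, a < c → (c : ℝ) < d → d < b → t ∈ Ioo (c : ℝ) d → P t := by
    simp only [ae_all_iff]
    exact fun c d hc hcd hd => hP c d hc hcd hd
  filter_upwards [hrat] with t ht htab
  obtain ⟨c, hac, hct⟩ := exists_rat_btwn htab.1
  obtain ⟨d, htd, hdb⟩ := exists_rat_btwn htab.2
  exact ht c d hac (hct.trans htd) hdb ⟨hct, htd⟩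

section MetricSpeed

variable {X : Type*} [MetricSpace X] {γ : ℝ → X} {a b : ℝ}

theorem exists_monotoneOn_dist_le (hab : a ≤ b) (hγ : AbsolutelyContinuousOnInterval γ a b) :
    ∃ V : ℝ → ℝ, MonotoneOn V (Icc a b) ∧
      ∀ s ∈ Icc a b, ∀ t ∈ Icc a b, dist (γ s) (γ t) ≤ |V s - V t| := by
  have hcont : ContinuousOn γ (Icc a b) :=
    uIcc_of_le hab ▸ continuousOn_of_absolutelyContinuousOnInterval hγ
  have : CompactSpace (γ '' Icc a b) :=
    isCompact_iff_compactSpace.1 (isCompact_Icc.image_of_continuousOn hcont)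
  -- Absolutely continuous curves are known to have bounded variation in normed spaces only.
  let φ : ℝ → lp (fun _ : ℕ => ℝ) ⊤ := fun t =>
    kuratowskiEmbedding (γ '' Icc a b)
      ⟨γ (projIcc a b hab t), mem_image_of_mem γ (projIcc a b hab t).2⟩
  have hφ : ∀ s ∈ Icc a b, ∀ t ∈ Icc a b, dist (φ s) (φ t) = dist (γ s) (γ t) := fun s hs t ht => by
    simp only [φ, (kuratowskiEmbedding.isometry _).dist_eq, Subtype.dist_eq,
      projIcc_of_mem hab hs, projIcc_of_mem hab ht]
  have hbv : LocallyBoundedVariationOn φ (Icc a b) := by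
    rw [← uIcc_of_le hab] at hφ ⊢
    exact (absolutelyContinuousOnInterval_of_dist_le 1 0 hγ hγ fun s hs t ht => by
      rw [hφ s hs t ht]; linarith).boundedVariationOn.locallyBoundedVariationOn
  have ha : a ∈ Icc a b := left_mem_Icc.2 hab
  refine ⟨variationOnFromTo φ (Icc a b) a, variationOnFromTo.monotoneOn hbv ha,
    fun s hs t ht => ?_⟩
  wlog hst : t ≤ s generalizing s t
  · rw [dist_comm, abs_sub_comm]
    exact this t ht s hs (le_of_not_ge hst)
  rw [← variationOnFromTo.add hbv ha ht hs, add_sub_cancel_left, ← hφ s hs t ht, dist_edist,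
    variationOnFromTo.eq_of_le _ _ hst]
  exact (ENNReal.toReal_mono (hbv t s ht hs)
    (eVariationOn.edist_le _ ⟨hs, right_mem_Icc.2 hst⟩ ⟨ht, left_mem_Icc.2 hst⟩)).trans
    (le_abs_self _)

theorem exists_intervalIntegrable_abs_deriv_dist_le (hab : a ≤ b)
    (hγ : AbsolutelyContinuousOnInterval γ a b) :
    ∃ g : ℝ → ℝ, IntervalIntegrable g volume a b ∧
      ∀ y : X, ∀ᵐ t : ℝ, t ∈ Ioo a b → |deriv (fun s => dist (γ s) y) t| ≤ g t := by
  obtain ⟨V, hmono, hV⟩ := exists_monotoneOn_dist_le hab hγ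
  refine ⟨deriv V, MonotoneOn.intervalIntegrable_deriv (by rwa [uIcc_of_le hab]), fun y => ?_⟩
  filter_upwards [hmono.ae_differentiableWithinAt_of_mem,
    (absolutelyContinuousOnInterval_dist_const hγ y).ae_differentiableAt] with t hVt hyt ht
  have htI : t ∈ Icc a b := Ioo_subset_Icc_self ht
  have hnhds : Icc a b ∈ 𝓝 t := Icc_mem_nhds ht.1 ht.2
  have hV' : HasDerivAt V (deriv V t) t := ((hVt htI).differentiableAt hnhds).hasDerivAt
  have hnonneg : 0 ≤ deriv V t := derivWithin_of_mem_nhds hnhds (f := V) ▸ hmono.derivWithin_nonneg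
  rw [← abs_of_nonneg hnonneg]
  refine le_of_tendsto_of_tendsto
    (tendsto_abs_sub_div_abs_sub (hyt (uIcc_of_le hab ▸ htI)).hasDerivAt)
    (tendsto_abs_sub_div_abs_sub hV') ?_
  filter_upwards [nhdsWithin_le_nhds hnhds] with s hs
  exact div_le_div_of_nonneg_right ((abs_dist_sub_le _ _ _).trans (hV s hs t htI)) (abs_nonneg _)

/-- The supremum over `n` of `|d/dt d(γ_t, y_n)|`. When `y` is dense in the image of an absolutely
continuous curve `γ`, this is a.e. the metric speed of `γ`. -/
noncomputable def distDerivSup (γ : ℝ → X) (y : ℕ → X) (t : ℝ) : ℝ :=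
  ⨆ n, |deriv (fun s => dist (γ s) (y n)) t|

theorem distDerivSup_nonneg (γ : ℝ → X) (y : ℕ → X) (t : ℝ) : 0 ≤ distDerivSup γ y t :=
  Real.iSup_nonneg fun _ => abs_nonneg _

theorem ae_abs_deriv_dist_le_distDerivSup (hab : a ≤ b)
    (hγ : AbsolutelyContinuousOnInterval γ a b) (y : ℕ → X) :
    ∀ᵐ t : ℝ, t ∈ Ioo a b → ∀ n, |deriv (fun s => dist (γ s) (y n)) t| ≤ distDerivSup γ y t := by
  obtain ⟨g, -, hg⟩ := exists_intervalIntegrable_abs_deriv_dist_le hab hγ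
  filter_upwards [ae_all_iff.2 fun n => hg (y n)] with t ht htab n
  exact le_ciSup (f := fun n => |deriv (fun s => dist (γ s) (y n)) t|)
    ⟨g t, forall_mem_range.2 fun n => ht n htab⟩ n

theorem intervalIntegrable_distDerivSup (hab : a ≤ b)
    (hγ : AbsolutelyContinuousOnInterval γ a b) (y : ℕ → X) :
    IntervalIntegrable (distDerivSup γ y) volume a b := by
  obtain ⟨g, hgint, hg⟩ := exists_intervalIntegrable_abs_deriv_dist_le hab hγ
  refine hgint.mono_fun'
    (Measurable.iSup fun n => (measurable_deriv _).abs).aestronglyMeasurable ?_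
  rw [uIoc_of_le hab, ← restrict_Ioo_eq_restrict_Ioc, EventuallyLE,
    ae_restrict_iff' measurableSet_Ioo]
  filter_upwards [ae_all_iff.2 fun n => hg (y n)] with t ht htab
  rw [Real.norm_of_nonneg (distDerivSup_nonneg γ y t)]
  exact ciSup_le fun n => ht n htab

theorem abs_dist_sub_dist_le_integral_distDerivSup (hab : a ≤ b)
    (hγ : AbsolutelyContinuousOnInterval γ a b) (y : ℕ → X) (n : ℕ) :
    |dist (γ b) (y n) - dist (γ a) (y n)| ≤ ∫ r in a..b, distDerivSup γ y r := by
  have hdist := absolutelyContinuousOnInterval_dist_const hγ (y n)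
  rw [← hdist.integral_deriv_eq_sub]
  refine (intervalIntegral.abs_integral_le_integral_abs hab).trans
    (intervalIntegral.integral_mono_ae_restrict hab hdist.intervalIntegrable_deriv.abs
      (intervalIntegrable_distDerivSup hab hγ y) ?_)
  rw [← restrict_Ioo_eq_restrict_Icc, EventuallyLE, ae_restrict_iff' measurableSet_Ioo]
  filter_upwards [ae_abs_deriv_dist_le_distDerivSup hab hγ y] with r hr hmem using hr hmem n

theorem dist_le_integral_distDerivSup (hab : a ≤ b) (hγ : AbsolutelyContinuousOnInterval γ a b)
    {y : ℕ → X} (hy : γ b ∈ closure (range y)) :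
    dist (γ a) (γ b) ≤ ∫ r in a..b, distDerivSup γ y r := by
  refine le_of_forall_pos_le_add fun ε hε => ?_
  obtain ⟨_, ⟨n, rfl⟩, hn⟩ := Metric.mem_closure_iff.1 hy (ε / 2) (half_pos hε)
  have hbound := abs_le.1 (abs_dist_sub_dist_le_integral_distDerivSup hab hγ y n)
  have htriangle := dist_triangle_right (γ a) (γ b) (y n)
  linarith

theorem dist_le_abs_integral_distDerivSup_sub (hγ : AbsolutelyContinuousOnInterval γ a b)
    {y : ℕ → X} (hy : ∀ t ∈ Icc a b, γ t ∈ closure (range y)) {s t : ℝ} (hs : s ∈ Icc a b)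
    (ht : t ∈ Icc a b) :
    dist (γ s) (γ t) ≤
      |(∫ r in a..s, distDerivSup γ y r) - ∫ r in a..t, distDerivSup γ y r| := by
  wlog hst : s ≤ t generalizing s t
  · rw [dist_comm, abs_sub_comm]
    exact this ht hs (le_of_not_ge hst)
  have hab : a ≤ b := hs.1.trans hs.2
  have hint : ∀ r ∈ Icc a b, IntervalIntegrable (distDerivSup γ y) volume a r := fun r hr =>
    intervalIntegrable_distDerivSup hr.1
      (hγ.mono (uIcc_subset_uIcc_left (uIcc_of_le hab ▸ hr))) y
  rw [abs_sub_comm, intervalIntegral.integral_interval_sub_left (hint t ht) (hint s hs)]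
  refine (dist_le_integral_distDerivSup hst (hγ.mono ?_) (hy t ht)).trans (le_abs_self _)
  exact uIcc_subset_uIcc (uIcc_of_le hab ▸ hs) (uIcc_of_le hab ▸ ht)

theorem ae_hasMetricSpeedAt_distDerivSup (hab : a ≤ b) (hγ : AbsolutelyContinuousOnInterval γ a b)
    {y : ℕ → X} (hy : ∀ t ∈ Icc a b, γ t ∈ closure (range y)) :
    ∀ᵐ t : ℝ, t ∈ Ioo a b → HasMetricSpeedAt γ (distDerivSup γ y t) t := by
  filter_upwards [ae_all_iff.2 fun n =>
      (absolutelyContinuousOnInterval_dist_const hγ (y n)).ae_differentiableAt,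
    (intervalIntegrable_distDerivSup hab hγ y).ae_hasDerivAt_integral] with t hdiff hint ht
  have htI : t ∈ Icc a b := Ioo_subset_Icc_self ht
  have htu : t ∈ uIcc a b := uIcc_of_le hab ▸ htI
  refine tendsto_order.2 ⟨fun c hc => ?_, fun c hc => ?_⟩
  · obtain ⟨n, hn⟩ := exists_lt_of_lt_ciSup hc
    filter_upwards [(tendsto_abs_sub_div_abs_sub (hdiff n htu).hasDerivAt).eventually
      (lt_mem_nhds hn)] with s hs
    refine hs.trans_le ?_
    gcongr
    exact abs_dist_sub_le _ _ _
  · have hlim := tendsto_abs_sub_div_abs_sub (hint htu a left_mem_uIcc)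
    rw [abs_of_nonneg (distDerivSup_nonneg γ y t)] at hlim
    filter_upwards [hlim.eventually (gt_mem_nhds hc),
      nhdsWithin_le_nhds (Icc_mem_nhds ht.1 ht.2)] with s hs hsI
    refine lt_of_le_of_lt ?_ hs
    gcongr
    exact dist_le_abs_integral_distDerivSup_sub hγ hy hsI htI

theorem ae_exists_hasMetricSpeedAt (hab : a ≤ b) (hγ : AbsolutelyContinuousOnInterval γ a b) :
    ∀ᵐ t : ℝ, t ∈ Ioo a b → ∃ v : ℝ, HasMetricSpeedAt γ v t := by
  have hcont : ContinuousOn γ (Icc a b) :=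
    uIcc_of_le hab ▸ continuousOn_of_absolutelyContinuousOnInterval hγ
  obtain ⟨D, hD, hsub⟩ := (isCompact_Icc.image_of_continuousOn hcont).isSeparable
  have hne : D.Nonempty := closure_nonempty_iff.1
    (((nonempty_Icc.2 hab).image γ).mono hsub)
  obtain ⟨y, rfl⟩ := hD.exists_eq_range hne
  filter_upwards [ae_hasMetricSpeedAt_distDerivSup hab hγ
    fun t ht => hsub (mem_image_of_mem γ ht)] with t ht htab using ⟨_, ht htab⟩

end MetricSpeed

/-- The primitive `∫₀ᵗ exp (lam r) dr` of the exponential weight, written `I_λ(t)` or `E_λ(t)` in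
the literature on evolution variational inequalities. -/
noncomputable def expIntegral (lam t : ℝ) : ℝ := ∫ r in (0 : ℝ)..t, Real.exp (lam * r)

section ExpIntegral

variable (lam : ℝ)

theorem integral_exp_mul_sub (s t : ℝ) :
    ∫ r in s..t, Real.exp (lam * (r - s)) = expIntegral lam (t - s) := by
  rw [expIntegral, intervalIntegral.integral_comp_sub_right (fun r => Real.exp (lam * r)), sub_self]

theorem hasDerivAt_expIntegral (t : ℝ) :
    HasDerivAt (expIntegral lam) (Real.exp (lam * t)) t :=
  (Continuous.integral_hasStrictDerivAt (by fun_prop) 0 t).hasDerivAt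

theorem expIntegral_zero : expIntegral lam 0 = 0 := intervalIntegral.integral_same

theorem expIntegral_pos {t : ℝ} (ht : 0 < t) : 0 < expIntegral lam t :=
  intervalIntegral.intervalIntegral_pos_of_pos
    (Continuous.intervalIntegrable (by fun_prop) _ _) (fun _ => Real.exp_pos _) ht

theorem tendsto_expIntegral_sub_div (t : ℝ) :
    Tendsto (fun s => expIntegral lam (s - t) / (s - t)) (𝓝[≠] t) (𝓝 1) := by
  have hderiv := (hasDerivAt_expIntegral lam (t - t)).comp_sub_const t t
  rw [sub_self, mul_zero, Real.exp_zero] at hderiv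
  exact (hasDerivAt_iff_tendsto_slope.1 hderiv).congr fun s => by
    rw [slope_def_field, sub_self, expIntegral_zero, sub_zero]

theorem mul_expIntegral (t : ℝ) : lam * expIntegral lam t = Real.exp (lam * t) - 1 := by
  have hderiv : ∀ r ∈ uIcc 0 t,
      HasDerivAt (fun r => Real.exp (lam * r)) (lam * Real.exp (lam * r)) r := fun r _ => by
    simpa only [mul_comm, mul_one, id] using ((hasDerivAt_id r).const_mul lam).exp
  rw [expIntegral, ← intervalIntegral.integral_const_mul,
    intervalIntegral.integral_eq_sub_of_hasDerivAt hderiv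
      (Continuous.intervalIntegrable (by fun_prop) _ _), mul_zero, Real.exp_zero]

theorem exp_neg_mul_expIntegral (t : ℝ) :
    Real.exp (-(lam * t)) * expIntegral lam t = expIntegral (-lam) t := by
  have hrefl := intervalIntegral.integral_comp_sub_left (a := 0) (b := t)
    (fun r => Real.exp (-lam * r)) t
  rw [sub_self, sub_zero] at hrefl
  rw [expIntegral, expIntegral, ← hrefl, ← intervalIntegral.integral_const_mul]
  refine intervalIntegral.integral_congr fun r _ => ?_
  rw [← Real.exp_add]
  ring_nf

variable {lam}

theorem exp_mul_le_exp_abs_mul {r T : ℝ} (hr : 0 ≤ r) (hrT : r ≤ T) :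
    Real.exp (lam * r) ≤ Real.exp (|lam| * T) :=
  Real.exp_le_exp.2 ((mul_le_mul_of_nonneg_right (le_abs_self lam) hr).trans
    (mul_le_mul_of_nonneg_left hrT (abs_nonneg lam)))

theorem exp_neg_abs_mul_le_exp_mul {r T : ℝ} (hr : 0 ≤ r) (hrT : r ≤ T) :
    Real.exp (-(|lam| * T)) ≤ Real.exp (lam * r) := by
  have hinv := exp_mul_le_exp_abs_mul (lam := -lam) hr hrT
  rw [abs_neg] at hinv
  calc Real.exp (-(|lam| * T)) ≤ Real.exp (-(-lam * r)) := by
        rw [Real.exp_neg, Real.exp_neg]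
        exact inv_anti₀ (Real.exp_pos _) hinv
    _ = Real.exp (lam * r) := by rw [neg_mul, neg_neg]

theorem expIntegral_le {t : ℝ} (ht : 0 ≤ t) : expIntegral lam t ≤ Real.exp (|lam| * t) * t := by
  have hmono := intervalIntegral.integral_mono_on (μ := volume) ht
    (f := fun r => Real.exp (lam * r)) (g := fun _ => Real.exp (|lam| * t))
    (Continuous.intervalIntegrable (by fun_prop) _ _)
    intervalIntegrable_const
    fun r hr => exp_mul_le_exp_abs_mul hr.1 hr.2
  rwa [intervalIntegral.integral_const, smul_eq_mul, sub_zero, mul_comm] at hmono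

theorem integral_exp_mul_sub_mul_le {s t K : ℝ} (hst : s ≤ t) (hK : 0 ≤ K) :
    ∫ r in s..t, Real.exp (lam * (r - s)) * (K * (r - s)) ≤
      Real.exp (|lam| * (t - s)) * K * (t - s) ^ 2 / 2 := by
  calc ∫ r in s..t, Real.exp (lam * (r - s)) * (K * (r - s))
      ≤ ∫ r in s..t, Real.exp (|lam| * (t - s)) * K * (r - s) := by
        refine intervalIntegral.integral_mono_on hst
          (Continuous.intervalIntegrable (by fun_prop) _ _)
          (Continuous.intervalIntegrable (by fun_prop) _ _) fun r hr => ?_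
        rw [mul_assoc]
        exact mul_le_mul_of_nonneg_right
          (exp_mul_le_exp_abs_mul (sub_nonneg.2 hr.1) (sub_le_sub_right hr.2 s))
          (mul_nonneg hK (sub_nonneg.2 hr.1))
    _ = Real.exp (|lam| * (t - s)) * K * (t - s) ^ 2 / 2 := by
        rw [intervalIntegral.integral_const_mul,
          intervalIntegral.integral_comp_sub_right (fun r => r), integral_id]
        ring

theorem integral_exp_mul_sub_mul_sub_le {s t A κ : ℝ} (hst : s ≤ t) (hκ : 0 ≤ κ) :
    ∫ r in s..t, Real.exp (lam * (r - s)) * (A - κ * (t - r)) ≤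
      A * expIntegral lam (t - s) - κ * Real.exp (-(|lam| * (t - s))) * (t - s) ^ 2 / 2 := by
  calc ∫ r in s..t, Real.exp (lam * (r - s)) * (A - κ * (t - r))
      ≤ ∫ r in s..t, (A * Real.exp (lam * (r - s)) -
          κ * Real.exp (-(|lam| * (t - s))) * (t - r)) := by
        refine intervalIntegral.integral_mono_on hst
          (Continuous.intervalIntegrable (by fun_prop) _ _)
          (Continuous.intervalIntegrable (by fun_prop) _ _) fun r hr => ?_
        have hexp := mul_le_mul_of_nonneg_right
          (exp_neg_abs_mul_le_exp_mul (lam := lam) (sub_nonneg.2 hr.1) (sub_le_sub_right hr.2 s))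
          (mul_nonneg hκ (sub_nonneg.2 hr.2))
        linarith
    _ = A * expIntegral lam (t - s) - κ * Real.exp (-(|lam| * (t - s))) * (t - s) ^ 2 / 2 := by
        rw [intervalIntegral.integral_sub (Continuous.intervalIntegrable (by fun_prop) _ _)
          (Continuous.intervalIntegrable (by fun_prop) _ _), intervalIntegral.integral_const_mul,
          intervalIntegral.integral_const_mul, integral_exp_mul_sub,
          intervalIntegral.integral_comp_sub_left (fun r => r), integral_id]
        ring

end ExpIntegral

theorem integral_sub_comp_add_le_of_antitoneOn {φ : ℝ → ℝ} {a c τ : ℝ} (hac : a ≤ c) (hτ : 0 ≤ τ)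
    (hφ : AntitoneOn φ (Icc a (c + τ))) :
    ∫ s in a..c, (φ s - φ (s + τ)) ≤ τ * (φ a - φ (c + τ)) := by
  have hint : ∀ x y, x ∈ Icc a (c + τ) → y ∈ Icc a (c + τ) → IntervalIntegrable φ volume x y :=
    fun x y hx hy => (hφ.mono (uIcc_subset_Icc hx hy)).intervalIntegrable
  have hmem : a ∈ Icc a (c + τ) ∧ c ∈ Icc a (c + τ) ∧ a + τ ∈ Icc a (c + τ) ∧
      c + τ ∈ Icc a (c + τ) := by
    refine ⟨?_, ?_, ?_, ?_⟩ <;> constructor <;> linarith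
  obtain ⟨ha, hc, haτ, hcτ⟩ := hmem
  have hstart : ∫ s in a..a + τ, φ s ≤ τ * φ a := by
    have := intervalIntegral.integral_mono_on (μ := volume) haτ.1 (hint _ _ ha haτ)
      (intervalIntegrable_const (c := φ a))
      fun r hr => hφ ha ⟨hr.1, hr.2.trans haτ.2⟩ hr.1
    rwa [intervalIntegral.integral_const, smul_eq_mul, add_sub_cancel_left] at this
  have hend : τ * φ (c + τ) ≤ ∫ s in c..c + τ, φ s := by
    have := intervalIntegral.integral_mono_on (μ := volume) hc.2
      (intervalIntegrable_const (c := φ (c + τ))) (hint _ _ hc hcτ)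
      fun r hr => hφ ⟨hc.1.trans hr.1, hr.2⟩ hcτ hr.2
    rwa [intervalIntegral.integral_const, smul_eq_mul, add_sub_cancel_left] at this
  rw [intervalIntegral.integral_sub (hint _ _ ha hc)
      (by simpa only [add_sub_cancel_right] using (hint _ _ haτ hcτ).comp_add_right τ),
    intervalIntegral.integral_comp_add_right φ,
    intervalIntegral.integral_interval_sub_interval_comm (hint _ _ ha hc) (hint _ _ haτ hcτ)
      (hint _ _ ha haτ)]
  linarith

/-- `E : X → (-∞, +∞]` is lower semicontinuous and proper, i.e. not identically `+∞`. -/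
structure ProperLSC {X : Type*} [TopologicalSpace X] (E : X → EReal) : Prop where
  ne_bot : ∀ x, E x ≠ ⊥
  lsc : LowerSemicontinuous E
  exists_ne_top : ∃ x, E x ≠ ⊤

theorem ProperLSC.coe_toReal {X : Type*} [TopologicalSpace X] {E : X → EReal} (hE : ProperLSC E)
    {x : X} (hx : E x ≠ ⊤) : ((E x).toReal : EReal) = E x :=
  EReal.coe_toReal hx (hE.ne_bot x)

section Slope

variable {X : Type*} [MetricSpace X] {E : X → EReal} {lam L : ℝ} {x y : X}

/-- `L` bounds the global slope `sup_z ([E(x) - E(z)] / d(x, z) + lam / 2 * d(x, z))⁺`, which is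
how the slope of a `lam`-convex functional is represented. Along `EVI_lam` flows this is a bound on
the descending slope which, unlike the latter, is closed under limits in `x`. -/
def GlobalSlopeLE (E : X → EReal) (lam L : ℝ) (x : X) : Prop :=
  ∀ z, E x ≤ E z + ((L * dist x z - lam / 2 * dist x z ^ 2 : ℝ) : EReal)

theorem isClosed_setOf_globalSlopeLE (hE : ProperLSC E) (lam L : ℝ) :
    IsClosed {x | GlobalSlopeLE E lam L x} := by
  simp only [GlobalSlopeLE, ofPred_forall]
  refine isClosed_iInter fun z => ?_
  by_cases hz : E z = ⊤
  · simp only [hz, EReal.top_add_coe, le_top, ofPred_true, isClosed_univ]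
  rw [← hE.coe_toReal hz]
  simp only [← EReal.coe_add]
  have hcont : Continuous fun x =>
      (((E z).toReal + (L * dist x z - lam / 2 * dist x z ^ 2) : ℝ) : EReal) :=
    continuous_coe_real_ereal.comp (by fun_prop)
  exact hE.lsc.isClosed_epigraph.preimage (continuous_id.prodMk hcont)

namespace GlobalSlopeLE

theorem toReal_le (hx : GlobalSlopeLE E lam L x) (hE : ProperLSC E) (hy : E y ≠ ⊤) :
    (E x).toReal ≤ (E y).toReal + (L * dist x y - lam / 2 * dist x y ^ 2) := by
  have hle := hx y
  rw [← hE.coe_toReal hy, ← EReal.coe_add] at hle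
  exact EReal.toReal_le_toReal hle (hE.ne_bot x) (EReal.coe_ne_top _)

theorem toReal_sub_le (hx : GlobalSlopeLE E lam L x) (hE : ProperLSC E) (hy : E y ≠ ⊤) :
    (E x).toReal - (E y).toReal ≤ (L + |lam| / 2 * dist x y) * dist x y := by
  have hle := hx.toReal_le hE hy
  have hlam := mul_le_mul_of_nonneg_right (neg_abs_le lam) (sq_nonneg (dist x y))
  linarith

theorem abs_toReal_sub_le {R : ℝ} (hx : GlobalSlopeLE E lam L x) (hy : GlobalSlopeLE E lam L y)
    (hE : ProperLSC E) (hxtop : E x ≠ ⊤) (hytop : E y ≠ ⊤) (hR : dist x y ≤ R) :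
    |(E x).toReal - (E y).toReal| ≤ (L + |lam| / 2 * R) * dist x y := by
  have hxy := hx.toReal_sub_le hE hytop
  have hyx := hy.toReal_sub_le hE hxtop
  rw [dist_comm y x] at hyx
  have hmono : (L + |lam| / 2 * dist x y) * dist x y ≤ (L + |lam| / 2 * R) * dist x y := by
    gcongr
  exact abs_sub_le_iff.2 ⟨hxy.trans hmono, hyx.trans hmono⟩

theorem descendingSlope_le (hx : GlobalSlopeLE E lam L x) (hE : ProperLSC E) (hxtop : E x ≠ ⊤) :
    descendingSlope E x ≤ ENNReal.ofReal L := by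
  rw [descendingSlope, if_neg hxtop]
  rcases (𝓝[≠] x).eq_or_neBot with hiso | hne
  · simp only [hiso, limsup_bot, bot_le]
  have hlim : Tendsto (fun z => ENNReal.ofReal (L + |lam| / 2 * dist x z)) (𝓝[≠] x)
      (𝓝 (ENNReal.ofReal L)) := by
    have hcont : Continuous fun z => ENNReal.ofReal (L + |lam| / 2 * dist x z) :=
      ENNReal.continuous_ofReal.comp (by fun_prop)
    simpa only [dist_self, mul_zero, add_zero] using
      (hcont.tendsto x).mono_left nhdsWithin_le_nhds
  rw [← hlim.limsup_eq]
  refine limsup_le_limsup (Eventually.of_forall fun z => ?_)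
  refine ENNReal.div_le_of_le_mul ?_
  by_cases hztop : E z = ⊤
  · simp only [hztop, EReal.sub_top, EReal.toENNReal_bot, zero_le]
  rw [edist_dist, ← ENNReal.ofReal_mul' dist_nonneg, ← hE.coe_toReal hxtop, ← hE.coe_toReal hztop,
    ← EReal.coe_sub, EReal.toENNReal_of_ne_top (EReal.coe_ne_top _), EReal.toReal_coe]
  exact ENNReal.ofReal_le_ofReal (hx.toReal_sub_le hE hztop)

end GlobalSlopeLE

theorem eventually_not_globalSlopeLE (hE : ProperLSC E) (hx : E x ≠ ⊤)
    (hL : ENNReal.ofReal L < descendingSlope E x) (lam : ℝ) :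
    ∀ᶠ y in 𝓝 x, ¬GlobalSlopeLE E lam L y :=
  (isClosed_setOf_globalSlopeLE hE lam L).isOpen_compl.eventually_mem fun hxL =>
    not_le.2 hL (hxL.descendingSlope_le hE hx)

theorem absolutelyContinuousOnInterval_toReal_of_globalSlopeLE {u : ℝ → X} {a b : ℝ}
    (hE : ProperLSC E) (hu : AbsolutelyContinuousOnInterval u a b)
    (htop : ∀ t ∈ uIcc a b, E (u t) ≠ ⊤) (hslope : ∀ t ∈ uIcc a b, GlobalSlopeLE E lam L (u t)) :
    AbsolutelyContinuousOnInterval (fun t => (E (u t)).toReal) a b := by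
  have hbdd : Bornology.IsBounded (u '' uIcc a b) :=
    (isCompact_uIcc.image_of_continuousOn
      (continuousOn_of_absolutelyContinuousOnInterval hu)).isBounded
  obtain ⟨R, hR⟩ := Metric.isBounded_iff.1 hbdd
  refine absolutelyContinuousOnInterval_of_dist_le (L + |lam| / 2 * R) 0 hu hu fun s hs t ht => ?_
  rw [zero_mul, add_zero]
  exact (hslope s hs).abs_toReal_sub_le (hslope t ht) hE (htop s hs) (htop t ht)
    (hR (mem_image_of_mem u hs) (mem_image_of_mem u ht))

end Slope

namespace IsEVIFlow

variable {X : Type*} [MetricSpace X] {E : X → EReal} {lam : ℝ} {u v : ℝ → X} {s t : ℝ}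

theorem continuousAt (hu : IsEVIFlow E lam u) (ht : 0 < t) : ContinuousAt u t := by
  have hcont := continuousOn_of_absolutelyContinuousOnInterval
    (hu.ac_loc (t / 2) (2 * t) (by linarith) (by linarith))
  rw [uIcc_of_le (by linarith)] at hcont
  exact hcont.continuousAt (Icc_mem_nhds (by linarith) (by linarith))

theorem comp_add_right (hu : IsEVIFlow E lam u) {τ : ℝ} (hτ : 0 ≤ τ) :
    IsEVIFlow E lam (fun t => u (t + τ)) := by
  refine ⟨fun a b ha hab => absolutelyContinuousOnInterval_comp_add_right τ
    (hu.ac_loc (a + τ) (b + τ) (by linarith) (by linarith)), fun y => ?_⟩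
  filter_upwards [(measurePreserving_add_right volume τ).quasiMeasurePreserving.ae (hu.evi y)]
    with t ht htpos
  obtain ⟨D, hD, hle⟩ := ht (by linarith)
  exact ⟨D, hD.comp_add_const t τ, hle⟩

theorem ne_top_of_evi {D : ℝ} {x y : X} (hy : E y ≠ ⊤)
    (hevi : ((1 / 2 * D + lam / 2 * dist x y ^ 2 : ℝ) : EReal) + E x ≤ E y) : E x ≠ ⊤ := by
  intro htop
  rw [htop, EReal.add_top_of_ne_bot (EReal.coe_ne_bot _), top_le_iff] at hevi
  exact hy hevi

theorem ae_hasDerivAt_weighted_dist_sq (hu : IsEVIFlow E lam u) (hE : ProperLSC E) {y : X}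
    (hy : E y ≠ ⊤) (s : ℝ) :
    ∀ᵐ r : ℝ, 0 < r → ∃ D : ℝ,
      HasDerivAt (fun r => Real.exp (lam * (r - s)) / 2 * dist (u r) y ^ 2) D r ∧
        ∀ g : ℝ, E y ≤ E (u r) + (g : EReal) → D ≤ Real.exp (lam * (r - s)) * g := by
  filter_upwards [hu.evi y] with r hr hrpos
  obtain ⟨D, hD, hevi⟩ := hr hrpos
  have hexp : HasDerivAt (fun r => Real.exp (lam * (r - s)) / 2)
      (Real.exp (lam * (r - s)) * lam / 2) r := by
    simpa only [mul_one, id] using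
      ((((hasDerivAt_id r).sub_const s).const_mul lam).exp.div_const 2)
  refine ⟨_, hexp.mul hD, fun g hg => ?_⟩
  have hle := hevi.trans hg
  lift E (u r) to ℝ using ⟨ne_top_of_evi hy hevi, hE.ne_bot _⟩ with e
  rw [← EReal.coe_add, ← EReal.coe_add, EReal.coe_le_coe_iff] at hle
  have hfactor := mul_le_mul_of_nonneg_left
    (show 1 / 2 * D + lam / 2 * dist (u r) y ^ 2 ≤ g by linarith)
    (Real.exp_pos (lam * (r - s))).le
  linarith

theorem integral_evi (hu : IsEVIFlow E lam u) (hE : ProperLSC E) (hs : 0 < s) (hst : s ≤ t)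
    {y : X} (hy : E y ≠ ⊤) {g : ℝ → ℝ} (hg : Continuous g)
    (hle : ∀ r ∈ Ioo s t, E y ≤ E (u r) + (g r : EReal)) :
    Real.exp (lam * (t - s)) / 2 * dist (u t) y ^ 2 - 1 / 2 * dist (u s) y ^ 2 ≤
      ∫ r in s..t, Real.exp (lam * (r - s)) * g r := by
  have hcont : Continuous fun r => Real.exp (lam * (r - s)) * g r := by fun_prop
  have hexp : AbsolutelyContinuousOnInterval (fun r => Real.exp (lam * (r - s)) / 2) s t :=
    ContDiffOn.absolutelyContinuousOnInterval (by fun_prop)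
  have hdist := absolutelyContinuousOnInterval_dist_const (hu.ac_loc s t hs hst) y
  have hint : AbsolutelyContinuousOnInterval
      (fun r => ∫ q in s..r, Real.exp (lam * (q - s)) * g q) s t :=
    IntervalIntegrable.absolutelyContinuousOnInterval_intervalIntegral
      (hcont.intervalIntegrable _ _) left_mem_uIcc
  have hdecr := le_of_ae_deriv_nonpos hst ((hexp.fun_mul (hdist.fun_mul hdist)).fun_sub hint) ?_
  · simp only [intervalIntegral.integral_same, sub_self, mul_zero, Real.exp_zero, ← pow_two,
      sub_zero] at hdecr
    linarith
  · filter_upwards [hu.ae_hasDerivAt_weighted_dist_sq hE hy s] with r hr hrst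
    obtain ⟨D, hD, hDle⟩ := hr (hs.trans hrst.1)
    simp only [← pow_two]
    rw [(hD.fun_sub (hcont.integral_hasStrictDerivAt s r).hasDerivAt).deriv, sub_nonpos]
    exact hDle _ (hle r hrst)

theorem antitoneOn_energy (hu : IsEVIFlow E lam u) (hE : ProperLSC E) :
    AntitoneOn (fun t => E (u t)) (Ioi 0) := by
  intro s hs t _ hst
  by_contra! hlt
  -- `q` is the last time in `[s, t]` at which the energy is at most `E (u s)`.
  have hcont : ContinuousOn u (Icc s t) := fun r hr =>
    (hu.continuousAt (lt_of_lt_of_le hs hr.1)).continuousWithinAt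
  have hcomp : IsCompact (Icc s t ∩ u ⁻¹' (E ⁻¹' Iic (E (u s)))) :=
    isCompact_Icc.of_isClosed_subset (hcont.preimage_isClosed_of_isClosed isClosed_Icc
      (hE.lsc.isClosed_preimage (E (u s)))) inter_subset_left
  obtain ⟨q, ⟨hq, hqE⟩, hmax⟩ := hcomp.exists_isGreatest ⟨s, left_mem_Icc.2 hst, le_refl (E (u s))⟩
  have hafter : ∀ r ∈ Ioo q t, E (u q) ≤ E (u r) + ((0 : ℝ) : EReal) := fun r hr => by
    rw [EReal.coe_zero, add_zero]
    refine le_trans hqE (le_of_not_ge fun hle => ?_)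
    exact (hmax ⟨⟨hq.1.trans hr.1.le, hr.2.le⟩, hle⟩).not_gt hr.1
  have hevi := hu.integral_evi hE (lt_of_lt_of_le hs hq.1) hq.2
    (lt_of_le_of_lt hqE (hlt.trans_le le_top)).ne continuous_const hafter
  simp only [dist_self, mul_zero, intervalIntegral.integral_zero] at hevi
  have hdist : dist (u t) (u q) ^ 2 ≤ 0 := by
    have hpos := Real.exp_pos (lam * (t - q))
    nlinarith
  rw [sq_nonpos_iff, dist_eq_zero] at hdist
  exact hlt.not_ge (hdist ▸ hqE)

theorem ne_top (hu : IsEVIFlow E lam u) (hE : ProperLSC E) (ht : 0 < t) : E (u t) ≠ ⊤ := by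
  obtain ⟨y, hy⟩ := hE.exists_ne_top
  have : (ae (volume.restrict (Ioo (0 : ℝ) t))).NeBot := ae_neBot.2 (by
    rw [Ne, Measure.restrict_eq_zero, Real.volume_Ioo, sub_zero, ENNReal.ofReal_eq_zero]
    exact ht.not_ge)
  obtain ⟨r, hr, hmem⟩ :=
    ((ae_restrict_of_ae (s := Ioo 0 t) (hu.evi y)).and (ae_restrict_mem measurableSet_Ioo)).exists
  obtain ⟨D, -, hevi⟩ := hr hmem.1
  exact ne_top_of_le_ne_top (ne_top_of_evi hy hevi)
    (hu.antitoneOn_energy hE hmem.1 ht hmem.2.le)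

theorem antitoneOn_toReal (hu : IsEVIFlow E lam u) (hE : ProperLSC E) :
    AntitoneOn (fun t => (E (u t)).toReal) (Ioi 0) := fun _ hs _ ht hst =>
  EReal.toReal_le_toReal (hu.antitoneOn_energy hE hs ht hst) (hE.ne_bot _) (hu.ne_top hE hs)

theorem integral_evi_toReal (hu : IsEVIFlow E lam u) (hE : ProperLSC E) (hs : 0 < s)
    (hst : s ≤ t) {y : X} (hy : E y ≠ ⊤) {g : ℝ → ℝ} (hg : Continuous g)
    (hle : ∀ r ∈ Ioo s t, (E y).toReal ≤ (E (u r)).toReal + g r) :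
    Real.exp (lam * (t - s)) / 2 * dist (u t) y ^ 2 - 1 / 2 * dist (u s) y ^ 2 ≤
      ∫ r in s..t, Real.exp (lam * (r - s)) * g r := by
  refine hu.integral_evi hE hs hst hy hg fun r hr => ?_
  rw [← hE.coe_toReal hy, ← hE.coe_toReal (hu.ne_top hE (hs.trans hr.1)), ← EReal.coe_add,
    EReal.coe_le_coe_iff]
  exact hle r hr

theorem evi_toReal (hu : IsEVIFlow E lam u) (hE : ProperLSC E) (hs : 0 < s) (hst : s ≤ t) {y : X}
    (hy : E y ≠ ⊤) :
    Real.exp (lam * (t - s)) / 2 * dist (u t) y ^ 2 - 1 / 2 * dist (u s) y ^ 2 ≤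
      ((E y).toReal - (E (u t)).toReal) * expIntegral lam (t - s) := by
  have hevi := hu.integral_evi_toReal hE hs hst hy
    (g := fun _ => (E y).toReal - (E (u t)).toReal) continuous_const fun r hr => by
      have hmono := hu.antitoneOn_toReal hE (hs.trans hr.1) (hs.trans_le hst) hr.2.le
      dsimp only at hmono
      linarith
  rwa [intervalIntegral.integral_mul_const, integral_exp_mul_sub,
    mul_comm (expIntegral lam (t - s))] at hevi

theorem ae_continuousAt_toReal (hu : IsEVIFlow E lam u) (hE : ProperLSC E) :
    ∀ᵐ t : ℝ, 0 < t → ContinuousAt (fun t => (E (u t)).toReal) t := by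
  filter_upwards [(hu.antitoneOn_toReal hE).neg.ae_differentiableWithinAt_of_mem] with t ht htpos
  simpa only [Pi.neg_def, neg_neg] using
    ((ht htpos).differentiableAt (Ioi_mem_nhds htpos)).continuousAt.neg

theorem weighted_dist_sq_sub_le (hu : IsEVIFlow E lam u) (hv : IsEVIFlow E lam v)
    (hE : ProperLSC E) (hs : 0 < s) (hst : s ≤ t) :
    Real.exp (lam * (t - s)) ^ 2 / 2 * dist (u t) (v t) ^ 2 - 1 / 2 * dist (u s) (v s) ^ 2 ≤
      (Real.exp (lam * (t - s)) * ((E (v t)).toReal - (E (u t)).toReal) +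
        ((E (u s)).toReal - (E (v t)).toReal)) * expIntegral lam (t - s) := by
  -- Testing `u` with `v t` and `v` with `u s` makes the mixed distances `dist (u s) (v t)` cancel.
  have hevi_u := hu.evi_toReal hE hs hst (hv.ne_top hE (hs.trans_le hst))
  have hevi_v := hv.evi_toReal hE hs hst (hu.ne_top hE hs)
  rw [dist_comm (v t), dist_comm (v s)] at hevi_v
  have hweighted := mul_le_mul_of_nonneg_left hevi_u (Real.exp_pos (lam * (t - s))).le
  linarith

theorem hasDerivAt_weighted_dist_sq_nonpos (hu : IsEVIFlow E lam u) (hv : IsEVIFlow E lam v)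
    (hE : ProperLSC E) (ht : 0 < t) (hφ : ContinuousAt (fun t => (E (u t)).toReal) t)
    (hψ : ContinuousAt (fun t => (E (v t)).toReal) t) {D : ℝ}
    (hD : HasDerivAt (fun t => Real.exp (lam * t) ^ 2 * dist (u t) (v t) ^ 2) D t) : D ≤ 0 := by
  set G : ℝ → ℝ := fun s => Real.exp (lam * (s - t)) * ((E (v s)).toReal - (E (u s)).toReal) +
    ((E (u t)).toReal - (E (v s)).toReal) with hG
  have hGlim : Tendsto G (𝓝[>] t) (𝓝 0) := by
    have hcont : ContinuousAt G t := by fun_prop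
    have hGt : G t = 0 := by simp only [hG, sub_self, mul_zero, Real.exp_zero]; ring
    exact hGt ▸ hcont.tendsto.mono_left nhdsWithin_le_nhds
  have hI := (tendsto_expIntegral_sub_div lam t).mono_left (nhdsGT_le_nhdsNE t)
  have hslope := (hasDerivAt_iff_tendsto_slope.1 hD).mono_left (nhdsGT_le_nhdsNE t)
  have hlim := (hGlim.mul hI).const_mul (2 * Real.exp (lam * t) ^ 2)
  rw [zero_mul, mul_zero] at hlim
  refine le_of_tendsto_of_tendsto hslope hlim ?_
  filter_upwards [self_mem_nhdsWithin] with s hs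
  rw [slope_def_field, ← mul_div_assoc, ← mul_div_assoc]
  refine div_le_div_of_nonneg_right ?_ (sub_nonneg.2 (le_of_lt hs))
  have hstep := mul_le_mul_of_nonneg_left (hu.weighted_dist_sq_sub_le hv hE ht (le_of_lt hs))
    (show 0 ≤ 2 * Real.exp (lam * t) ^ 2 by positivity)
  have hexp : Real.exp (lam * s) = Real.exp (lam * t) * Real.exp (lam * (s - t)) := by
    rw [← Real.exp_add]; ring_nf
  rw [hexp]
  linarith

theorem contraction (hu : IsEVIFlow E lam u) (hv : IsEVIFlow E lam v) (hE : ProperLSC E)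
    (hs : 0 < s) (hst : s ≤ t) :
    dist (u t) (v t) ≤ Real.exp (-(lam * (t - s))) * dist (u s) (v s) := by
  have hexp : AbsolutelyContinuousOnInterval (fun r => Real.exp (lam * r) ^ 2) s t :=
    ContDiffOn.absolutelyContinuousOnInterval (by fun_prop)
  have hdist := absolutelyContinuousOnInterval_dist (hu.ac_loc s t hs hst) (hv.ac_loc s t hs hst)
  have hF := hexp.fun_mul (hdist.fun_mul hdist)
  simp only [← pow_two] at hF
  have hdecr := le_of_ae_deriv_nonpos hst hF (by
    filter_upwards [hF.ae_differentiableAt, hu.ae_continuousAt_toReal hE,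
      hv.ae_continuousAt_toReal hE] with r hr hφ hψ hmem
    have hrpos : 0 < r := hs.trans hmem.1
    exact hu.hasDerivAt_weighted_dist_sq_nonpos hv hE hrpos (hφ hrpos) (hψ hrpos)
      (hr (uIcc_of_le hst ▸ Ioo_subset_Icc_self hmem)).hasDerivAt)
  rw [← mul_pow, ← mul_pow] at hdecr
  have hle := (pow_le_pow_iff_left₀ (by positivity) (by positivity) two_ne_zero).1 hdecr
  calc dist (u t) (v t)
      = Real.exp (-(lam * t)) * (Real.exp (lam * t) * dist (u t) (v t)) := by
        rw [← mul_assoc, ← Real.exp_add, neg_add_cancel, Real.exp_zero, one_mul]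
    _ ≤ Real.exp (-(lam * t)) * (Real.exp (lam * s) * dist (u s) (v s)) := by gcongr
    _ = Real.exp (-(lam * (t - s))) * dist (u s) (v s) := by
        rw [← mul_assoc, ← Real.exp_add]; ring_nf

theorem toReal_le_of_dist_le (hu : IsEVIFlow E lam u) (hE : ProperLSC E) (ht : 0 < t)
    (hts : t < s) {L : ℝ} (hL : dist (u s) (u t) ≤ L * (s - t)) {z : X} (hz : E z ≠ ⊤) :
    (E (u s)).toReal ≤ (E z).toReal +
      (Real.exp (lam * (s - t)) * L * (expIntegral lam (s - t) / (s - t))⁻¹ * dist (u t) z -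
        lam / 2 * dist (u t) z ^ 2) := by
  have hI := expIntegral_pos lam (sub_pos.2 hts)
  have hevi := hu.evi_toReal hE ht hts.le hz
  have hsq : dist (u t) z ^ 2 - 2 * dist (u t) z * (L * (s - t)) ≤ dist (u s) z ^ 2 := by
    have htriangle := dist_triangle_left (u t) z (u s)
    have hmul := mul_le_mul_of_nonneg_left (htriangle.trans (add_le_add_left hL _))
      (dist_nonneg (x := u t) (y := z))
    linarith [sq_nonneg (dist (u t) z - dist (u s) z)]
  have hweighted := mul_le_mul_of_nonneg_left hsq (Real.exp_pos (lam * (s - t))).le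
  have hexp : Real.exp (lam * (s - t)) = lam * expIntegral lam (s - t) + 1 := by
    rw [mul_expIntegral, sub_add_cancel]
  have hmain : ((E (u s)).toReal - (E z).toReal + lam / 2 * dist (u t) z ^ 2) *
      expIntegral lam (s - t) ≤ Real.exp (lam * (s - t)) * L * (s - t) * dist (u t) z := by
    linear_combination hevi + hweighted / 2 - dist (u t) z ^ 2 / 2 * hexp
  rw [← le_div_iff₀ hI] at hmain
  rw [inv_div]
  linarith [show Real.exp (lam * (s - t)) * L * (s - t) * dist (u t) z / expIntegral lam (s - t) =
    Real.exp (lam * (s - t)) * L * ((s - t) / expIntegral lam (s - t)) * dist (u t) z by ring]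

theorem globalSlopeLE_of_eventually_dist_le (hu : IsEVIFlow E lam u) (hE : ProperLSC E)
    (ht : 0 < t) {L : ℝ} (hL : ∀ᶠ s in 𝓝[>] t, dist (u s) (u t) ≤ L * (s - t)) :
    GlobalSlopeLE E lam L (u t) := fun z => by
  by_cases hz : E z = ⊤
  · simp only [hz, EReal.top_add_coe, le_top]
  have hI := ((tendsto_expIntegral_sub_div lam t).mono_left (nhdsGT_le_nhdsNE t)).inv₀ one_ne_zero
  have hexp : Tendsto (fun s => Real.exp (lam * (s - t)) * L) (𝓝[>] t) (𝓝 L) := by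
    have hcont : Continuous fun s => Real.exp (lam * (s - t)) * L := by fun_prop
    simpa only [sub_self, mul_zero, Real.exp_zero, one_mul] using
      (hcont.tendsto t).mono_left nhdsWithin_le_nhds
  have hbound := (((hexp.mul hI).mul_const (dist (u t) z)).sub_const
    (lam / 2 * dist (u t) z ^ 2)).const_add (E z).toReal
  rw [inv_one, mul_one] at hbound
  rw [← hE.coe_toReal hz, ← EReal.coe_add]
  refine hE.lsc.isClosed_epigraph.mem_of_tendsto
    (((hu.continuousAt ht).mono_left nhdsWithin_le_nhds).prodMk_nhds
      ((continuous_coe_real_ereal.tendsto _).comp hbound)) ?_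
  filter_upwards [hL, self_mem_nhdsWithin] with s hs hts
  have hle := EReal.coe_le_coe_iff.2 (hu.toReal_le_of_dist_le hE ht hts hs hz)
  rwa [hE.coe_toReal (hu.ne_top hE (ht.trans hts))] at hle

theorem dist_sq_add_le (hu : IsEVIFlow E lam u) (hE : ProperLSC E) {τ T : ℝ} (hs : 0 < s)
    (hst : s ≤ t) (hτ : 0 ≤ τ) (htT : t + τ ≤ T) :
    dist (u (t + τ)) (u t) ^ 2 ≤
      2 * Real.exp (|lam| * T) ^ 3 * τ * ((E (u s)).toReal - (E (u (s + τ))).toReal) := by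
  have hsτ : s ≤ s + τ := le_add_of_nonneg_right hτ
  set K := Real.exp (|lam| * T) with hK
  set drop := (E (u s)).toReal - (E (u (s + τ))).toReal
  have hdrop0 : 0 ≤ drop := sub_nonneg.2 (hu.antitoneOn_toReal hE hs (hs.trans_le hsτ) hsτ)
  have hcontr : dist (u (t + τ)) (u t) ≤ K * dist (u (s + τ)) (u s) := by
    refine ((hu.comp_add_right hτ).contraction hu hE hs hst).trans ?_
    gcongr
    rw [← neg_mul, hK, ← abs_neg lam]
    exact exp_mul_le_exp_abs_mul (sub_nonneg.2 hst) (by linarith)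
  have hevi : dist (u (s + τ)) (u s) ^ 2 ≤ 2 * drop * (K * τ) := by
    have hI : Real.exp (-(lam * τ)) * expIntegral lam τ ≤ K * τ := by
      rw [exp_neg_mul_expIntegral]
      refine (expIntegral_le hτ).trans ?_
      rw [abs_neg, hK]
      gcongr
      linarith
    have hflow := hu.evi_toReal hE hs hsτ (hu.ne_top hE hs)
    rw [dist_self, add_sub_cancel_left] at hflow
    have hcancel : Real.exp (-(lam * τ)) * Real.exp (lam * τ) = 1 := by
      rw [← Real.exp_add, neg_add_cancel, Real.exp_zero]
    have hweighted := mul_le_mul_of_nonneg_left hflow (Real.exp_pos (-(lam * τ))).le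
    have hbound := mul_le_mul_of_nonneg_left hI hdrop0
    linear_combination 2 * hweighted + 2 * hbound - dist (u (s + τ)) (u s) ^ 2 * hcancel
  calc dist (u (t + τ)) (u t) ^ 2 ≤ (K * dist (u (s + τ)) (u s)) ^ 2 := by gcongr
    _ = K ^ 2 * dist (u (s + τ)) (u s) ^ 2 := by ring
    _ ≤ K ^ 2 * (2 * drop * (K * τ)) := by gcongr
    _ = 2 * K ^ 3 * τ * drop := by ring

theorem mul_dist_sq_add_le (hu : IsEVIFlow E lam u) (hE : ProperLSC E) {a c τ T : ℝ}
    (ha : 0 < a) (hac : a ≤ c) (hct : c ≤ t) (hτ : 0 ≤ τ) (htT : t + τ ≤ T) :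
    (c - a) * dist (u (t + τ)) (u t) ^ 2 ≤
      2 * Real.exp (|lam| * T) ^ 3 * τ ^ 2 * ((E (u a)).toReal - (E (u T)).toReal) := by
  -- `dist_sq_add_le` controls the increment by the energy drop from any earlier `r` to `r + τ`;
  -- averaging over `r ∈ [a, c]` telescopes the drops and gains the second factor `τ`.
  have hanti := hu.antitoneOn_toReal hE
  have hIcc : Icc a (c + τ) ⊆ Ioi 0 := fun r hr => ha.trans_le hr.1
  have hint : IntervalIntegrable (fun r => (E (u r)).toReal - (E (u (r + τ))).toReal)
      volume a c := by
    have hpos : uIcc a c ⊆ Ioi 0 := by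
      rw [uIcc_of_le hac]
      exact fun r hr => ha.trans_le hr.1
    exact (hanti.mono hpos).intervalIntegrable.sub
      (AntitoneOn.intervalIntegrable fun r hr q hq hrq =>
        hanti (add_pos_of_pos_of_nonneg (hpos hr) hτ) (add_pos_of_pos_of_nonneg (hpos hq) hτ)
          (by linarith))
  have haverage : (c - a) * dist (u (t + τ)) (u t) ^ 2 ≤
      2 * Real.exp (|lam| * T) ^ 3 * τ *
        ∫ r in a..c, ((E (u r)).toReal - (E (u (r + τ))).toReal) := by
    rw [← intervalIntegral.integral_const_mul, ← smul_eq_mul (c - a),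
      ← intervalIntegral.integral_const]
    exact intervalIntegral.integral_mono_on hac intervalIntegrable_const
      (hint.const_mul _) fun r hr =>
        hu.dist_sq_add_le hE (ha.trans_le hr.1) (hr.2.trans hct) hτ htT
  have hdrop : ∫ r in a..c, ((E (u r)).toReal - (E (u (r + τ))).toReal) ≤
      τ * ((E (u a)).toReal - (E (u T)).toReal) := by
    refine (integral_sub_comp_add_le_of_antitoneOn hac hτ (hanti.mono hIcc)).trans ?_
    have hend : (E (u T)).toReal ≤ (E (u (c + τ))).toReal :=
      hanti (hIcc ⟨by linarith, le_rfl⟩) (show 0 < T by linarith) (by linarith)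
    gcongr
  refine haverage.trans ((mul_le_mul_of_nonneg_left hdrop (by positivity)).trans_eq ?_)
  ring

theorem dist_le_of_toReal_sub_le (hu : IsEVIFlow E lam u) (hE : ProperLSC E) {a c T M : ℝ}
    (ha : 0 < a) (hac : a < c) (hM : (E (u a)).toReal - (E (u T)).toReal ≤ M)
    (hs : s ∈ Icc c T) (ht : t ∈ Icc c T) :
    dist (u s) (u t) ≤ √(2 * Real.exp (|lam| * T) ^ 3 * M / (c - a)) * |s - t| := by
  wlog hts : t ≤ s generalizing s t
  · rw [dist_comm, abs_sub_comm]
    exact this ht hs (le_of_not_ge hts)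
  have hτ : 0 ≤ s - t := sub_nonneg.2 hts
  have hsq := hu.mul_dist_sq_add_le hE ha hac.le ht.1 hτ ((add_sub_cancel t s).trans_le hs.2)
  rw [add_sub_cancel] at hsq
  calc dist (u s) (u t)
      ≤ √(2 * Real.exp (|lam| * T) ^ 3 * M / (c - a) * (s - t) ^ 2) := by
        refine Real.le_sqrt_of_sq_le ?_
        rw [div_mul_eq_mul_div, le_div_iff₀ (sub_pos.2 hac), mul_comm]
        refine hsq.trans ((mul_le_mul_of_nonneg_left hM (by positivity)).trans_eq ?_)
        ring
    _ = √(2 * Real.exp (|lam| * T) ^ 3 * M / (c - a)) * |s - t| := by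
        rw [Real.sqrt_mul' _ (sq_nonneg _), Real.sqrt_sq_eq_abs]

theorem exists_forall_dist_le (hu : IsEVIFlow E lam u) (hE : ProperLSC E) {c : ℝ} (hc : 0 < c)
    (T : ℝ) :
    ∃ L, 0 ≤ L ∧ ∀ s ∈ Icc c T, ∀ t ∈ Icc c T, dist (u s) (u t) ≤ L * |s - t| :=
  ⟨_, Real.sqrt_nonneg _, fun _ hs _ ht =>
    hu.dist_le_of_toReal_sub_le hE (half_pos hc) (half_lt_self hc) le_rfl hs ht⟩

theorem globalSlopeLE_of_dist_le (hu : IsEVIFlow E lam u) (hE : ProperLSC E) {c T L : ℝ}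
    (hc : 0 < c) (hL : ∀ s ∈ Icc c T, ∀ t ∈ Icc c T, dist (u s) (u t) ≤ L * |s - t|)
    (ht : t ∈ Ico c T) : GlobalSlopeLE E lam L (u t) := by
  refine hu.globalSlopeLE_of_eventually_dist_le hE (hc.trans_le ht.1) ?_
  filter_upwards [Ioo_mem_nhdsGT ht.2] with s hs
  have hle := hL s ⟨ht.1.trans hs.1.le, hs.2.le⟩ t ⟨ht.1, ht.2.le⟩
  rwa [abs_of_pos (sub_pos.2 hs.1)] at hle

theorem exists_globalSlopeLE (hu : IsEVIFlow E lam u) (hE : ProperLSC E) (ht : 0 < t) :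
    ∃ L, 0 ≤ L ∧ GlobalSlopeLE E lam L (u t) := by
  obtain ⟨L, hL0, hL⟩ := hu.exists_forall_dist_le hE ht (t + 1)
  exact ⟨L, hL0, hu.globalSlopeLE_of_dist_le hE ht hL ⟨le_rfl, lt_add_one t⟩⟩

theorem absolutelyContinuousOnInterval_toReal (hu : IsEVIFlow E lam u) (hE : ProperLSC E)
    (hs : 0 < s) (hst : s ≤ t) :
    AbsolutelyContinuousOnInterval (fun t => (E (u t)).toReal) s t := by
  obtain ⟨L, -, hL⟩ := hu.exists_forall_dist_le hE hs (t + 1)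
  refine absolutelyContinuousOnInterval_toReal_of_globalSlopeLE hE (hu.ac_loc s t hs hst)
    (fun r hr => hu.ne_top hE ?_) fun r hr => hu.globalSlopeLE_of_dist_le hE hs hL ?_
  all_goals rw [uIcc_of_le hst] at hr
  exacts [hs.trans_le hr.1, ⟨hr.1, hr.2.trans_lt (lt_add_one t)⟩]

theorem eventually_dist_le_of_hasDerivAt (hu : IsEVIFlow E lam u) (hE : ProperLSC E) (ht : 0 < t)
    {D c : ℝ} (hD : HasDerivAt (fun t => (E (u t)).toReal) D t) (hc : 0 ≤ c) (hDc : -D < c ^ 2) :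
    ∀ᶠ s in 𝓝[>] t, dist (u s) (u t) ≤ c * (s - t) := by
  have hslope := (hasDerivAt_iff_tendsto_slope.1 hD).mono_left (nhdsGT_le_nhdsNE t)
  have hD0 : D ≤ 0 := by
    refine le_of_tendsto hslope ?_
    filter_upwards [self_mem_nhdsWithin] with s (hs : t < s)
    rw [slope_def_field]
    exact div_nonpos_of_nonpos_of_nonneg
      (sub_nonpos.2 (hu.antitoneOn_toReal hE ht (ht.trans hs) hs.le)) (sub_nonneg.2 hs.le)
  obtain ⟨K, hDK, hKc⟩ := exists_between hDc
  have hK : 0 ≤ K := (neg_nonneg.2 hD0).trans hDK.le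
  have hnear : ∀ᶠ r in 𝓝[>] t, (E (u t)).toReal ≤ (E (u r)).toReal + K * (r - t) := by
    filter_upwards [hslope.eventually (lt_mem_nhds (neg_lt.1 hDK)), self_mem_nhdsWithin] with r hr
      (htr : t < r)
    rw [slope_def_field, lt_div_iff₀ (sub_pos.2 htr)] at hr
    linarith
  obtain ⟨η, hη, hsub⟩ := mem_nhdsGT_iff_exists_Ioo_subset.1 hnear
  have hexp : Tendsto (fun s => Real.exp ((|lam| - lam) * (s - t)) * K) (𝓝[>] t) (𝓝 K) := by
    have hcont : Continuous fun s => Real.exp ((|lam| - lam) * (s - t)) * K := by fun_prop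
    simpa only [sub_self, mul_zero, Real.exp_zero, one_mul] using
      (hcont.tendsto t).mono_left nhdsWithin_le_nhds
  filter_upwards [hexp.eventually (gt_mem_nhds hKc), Ioo_mem_nhdsGT hη] with s hs hsη
  have hevi := (hu.integral_evi_toReal hE ht hsη.1.le (hu.ne_top hE ht)
    (g := fun r => K * (r - t)) (by fun_prop) fun r hr => hsub ⟨hr.1, hr.2.trans hsη.2⟩).trans
      (integral_exp_mul_sub_mul_le hsη.1.le hK)
  rw [dist_self] at hevi
  have hweighted := mul_le_mul_of_nonneg_left hevi (Real.exp_pos (-(lam * (s - t)))).le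
  have hcancel : Real.exp (-(lam * (s - t))) * Real.exp (lam * (s - t)) = 1 := by
    rw [← Real.exp_add, neg_add_cancel, Real.exp_zero]
  have hsplit : Real.exp ((|lam| - lam) * (s - t)) =
      Real.exp (-(lam * (s - t))) * Real.exp (|lam| * (s - t)) := by
    rw [← Real.exp_add]
    ring_nf
  rw [hsplit] at hs
  refine le_of_abs_le (abs_le_of_sq_le_sq ?_ (mul_nonneg hc (sub_nonneg.2 hsη.1.le)))
  linear_combination 2 * hweighted + (s - t) ^ 2 * hs - dist (u s) (u t) ^ 2 * hcancel

theorem energy_dissipation (hu : IsEVIFlow E lam u) (hE : ProperLSC E) {c : ℝ} (hs : 0 < s)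
    (hst : s ≤ t) (hc : 0 ≤ c) (hsteep : ∀ r ∈ Ioo s t, ¬GlobalSlopeLE E lam c (u r)) :
    (E (u t)).toReal + c ^ 2 * (t - s) ≤ (E (u s)).toReal := by
  have hφ := hu.absolutelyContinuousOnInterval_toReal hE hs hst
  have hdecr := le_of_ae_deriv_nonpos hst
    (hφ.fun_add (absolutelyContinuousOnInterval_id.const_mul (c ^ 2))) ?_
  · linarith
  filter_upwards [hφ.ae_differentiableAt] with r hr hmem
  have hrpos : 0 < r := hs.trans hmem.1
  have hD := (hr (uIcc_of_le hst ▸ Ioo_subset_Icc_self hmem)).hasDerivAt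
  rw [(hD.fun_add ((hasDerivAt_id' r).const_mul (c ^ 2))).deriv, mul_one]
  by_contra! hpos
  exact hsteep r hmem (hu.globalSlopeLE_of_eventually_dist_le hE hrpos
    (hu.eventually_dist_le_of_hasDerivAt hE hrpos hD hc (by linarith)))

theorem descendingSlope_ne_top (hu : IsEVIFlow E lam u) (hE : ProperLSC E) (ht : 0 < t) :
    descendingSlope E (u t) ≠ ⊤ := by
  obtain ⟨L, -, hL⟩ := hu.exists_globalSlopeLE hE ht
  exact ((hL.descendingSlope_le hE (hu.ne_top hE ht)).trans_lt ENNReal.ofReal_lt_top).ne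

end IsEVIFlow

namespace IsEVIFlowFrom

variable {X : Type*} [MetricSpace X] {E : X → EReal} {lam : ℝ} {u v : ℝ → X} {x y : X} {t : ℝ}

theorem dist_le (hu : IsEVIFlowFrom E lam u x) (hv : IsEVIFlowFrom E lam v y) (hE : ProperLSC E)
    (ht : 0 < t) : dist (u t) (v t) ≤ Real.exp (-(lam * t)) * dist x y := by
  have hexp : Tendsto (fun s => Real.exp (-(lam * (t - s)))) (𝓝[>] 0)
      (𝓝 (Real.exp (-(lam * t)))) := by
    have hcont : Continuous fun s => Real.exp (-(lam * (t - s))) := by fun_prop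
    simpa only [sub_zero] using (hcont.tendsto 0).mono_left nhdsWithin_le_nhds
  refine ge_of_tendsto (hexp.mul (hu.tendsto_start.dist hv.tendsto_start)) ?_
  filter_upwards [Ioo_mem_nhdsGT ht] with s hs
  exact hu.flow.contraction hv.flow hE hs.1 hs.2.le

theorem toReal_le (hu : IsEVIFlowFrom E lam u x) (hE : ProperLSC E) (ht : 0 < t) (hy : E y ≠ ⊤) :
    (E (u t)).toReal ≤ (E y).toReal + dist x y ^ 2 / (2 * expIntegral lam t) := by
  have hI : Tendsto (fun s => expIntegral lam (t - s)) (𝓝[>] 0) (𝓝 (expIntegral lam t)) := by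
    have hcont : ContinuousAt (fun s => expIntegral lam (t - s)) 0 :=
      (hasDerivAt_expIntegral lam (t - 0)).continuousAt.comp (by fun_prop)
    simpa only [sub_zero] using hcont.tendsto.mono_left nhdsWithin_le_nhds
  have hlim : ((E (u t)).toReal - (E y).toReal) * expIntegral lam t ≤ 1 / 2 * dist x y ^ 2 := by
    refine le_of_tendsto_of_tendsto (hI.const_mul _)
      (((hu.tendsto_start.dist tendsto_const_nhds).pow 2).const_mul (1 / 2)) ?_
    filter_upwards [Ioo_mem_nhdsGT ht] with s hs
    have hevi := hu.flow.evi_toReal hE hs.1 hs.2.le hy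
    have hnonneg : 0 ≤ Real.exp (lam * (t - s)) / 2 * dist (u t) y ^ 2 := by positivity
    linarith
  rw [← le_div_iff₀ (expIntegral_pos lam ht), sub_le_iff_le_add'] at hlim
  exact hlim.trans_eq (by ring)

theorem eviSemigroup_eq (hu : IsEVIFlowFrom E lam u x) (hE : ProperLSC E) (ht : 0 < t) :
    eviSemigroup E lam t x = u t := by
  have hex : ∃ u, IsEVIFlowFrom E lam u x := ⟨u, hu⟩
  rw [eviSemigroup, dif_pos hex, if_pos ht]
  exact dist_le_zero.1 ((hex.choose_spec.dist_le hu hE ht).trans_eq (by rw [dist_self, mul_zero]))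

theorem exists_forall_toReal_sub_le (hE : ProperLSC E) (lam : ℝ) {B : Set X}
    (hB : Bornology.IsBounded B) {a T : ℝ} (ha : 0 < a) (hT : 0 < T) :
    ∃ M : ℝ, ∀ x ∈ B, ∀ u, IsEVIFlowFrom E lam u x →
      (E (u a)).toReal - (E (u T)).toReal ≤ M := by
  by_cases hflow : ∃ x₀ ∈ B, ∃ v, IsEVIFlowFrom E lam v x₀
  swap
  · exact ⟨0, fun x hx u hu => absurd ⟨x, hx, u, hu⟩ hflow⟩
  obtain ⟨x₀, hx₀, v, hv⟩ := hflow
  obtain ⟨y, hy⟩ := hE.exists_ne_top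
  obtain ⟨L, hL0, hL⟩ := hv.flow.exists_globalSlopeLE hE hT
  obtain ⟨R, hR⟩ := hB.subset_closedBall y
  set D := Real.exp (-(lam * T)) * Metric.diam B
  have hI := expIntegral_pos lam ha
  refine ⟨(E y).toReal + R ^ 2 / (2 * expIntegral lam a) -
    ((E (v T)).toReal - (L + |lam| / 2 * D) * D), fun x hx u hu => sub_le_sub ?_ ?_⟩
  · refine (hu.toReal_le hE ha hy).trans ?_
    gcongr
    exact hR hx
  -- A global slope bound at a single point bounds the energy below on bounded sets.
  · have hdist : dist (v T) (u T) ≤ D := (hv.dist_le hu hE hT).trans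
      (mul_le_mul_of_nonneg_left (Metric.dist_le_diam_of_mem hB hx₀ hx) (Real.exp_pos _).le)
    have hslope := hL.toReal_sub_le hE (hu.flow.ne_top hE hT)
    have hbound : (L + |lam| / 2 * dist (v T) (u T)) * dist (v T) (u T) ≤
        (L + |lam| / 2 * D) * D := by gcongr
    linarith

theorem exists_forall_dist_le (hE : ProperLSC E) (lam : ℝ) {B : Set X}
    (hB : Bornology.IsBounded B) {c T : ℝ} (hc : 0 < c) (hT : 0 < T) :
    ∃ L : ℝ, ∀ x ∈ B, ∀ u, IsEVIFlowFrom E lam u x →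
      ∀ s ∈ Icc c T, ∀ t ∈ Icc c T, dist (u s) (u t) ≤ L * |s - t| := by
  obtain ⟨M, hM⟩ := exists_forall_toReal_sub_le hE lam hB (half_pos hc) hT
  exact ⟨_, fun x hx u hu s hs t ht => hu.flow.dist_le_of_toReal_sub_le hE (half_pos hc)
    (half_lt_self hc) (hM x hx u hu) hs ht⟩

theorem tendsto_of_tendsto_start (hu : IsEVIFlowFrom E lam u x) (hE : ProperLSC E) {ι : Type*}
    {l : Filter ι} {w : ι → ℝ → X} {z : ι → X} (hw : ∀ᶠ i in l, IsEVIFlowFrom E lam (w i) (z i))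
    (hz : Tendsto z l (𝓝 x)) (ht : 0 < t) :
    Tendsto (fun p : ι × ℝ => w p.1 p.2) (l ×ˢ 𝓝 t) (𝓝 (u t)) := by
  have hut : Tendsto (fun p : ι × ℝ => u p.2) (l ×ˢ 𝓝 t) (𝓝 (u t)) :=
    (hu.flow.continuousAt ht).tendsto.comp tendsto_snd
  refine hut.congr_dist ?_
  have hexp : Tendsto (fun p : ι × ℝ => Real.exp (-(lam * p.2))) (l ×ˢ 𝓝 t)
      (𝓝 (Real.exp (-(lam * t)))) := by
    have hcont : Continuous fun r => Real.exp (-(lam * r)) := by fun_prop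
    exact (hcont.tendsto t).comp tendsto_snd
  have hbound := hexp.mul ((tendsto_const_nhds (x := x)).dist (hz.comp tendsto_fst))
  rw [dist_self, mul_zero] at hbound
  refine squeeze_zero' (Eventually.of_forall fun _ => dist_nonneg) ?_ hbound
  filter_upwards [hw.prod_inl _, (lt_mem_nhds ht).prod_inr _] with p hp htp
  exact hu.dist_le hp hE htp

end IsEVIFlowFrom

section RegularizedCurve

variable {X : Type*} [MetricSpace X] {E : X → EReal} {lam : ℝ} {v : ℝ → ℝ → X} {γ : ℝ → X}
  {h : ℝ → ℝ} {a b t : ℝ}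

theorem exp_neg_mul_sq (lam t : ℝ) : Real.exp (-(lam * t)) ^ 2 = Real.exp (-2 * lam * t) := by
  rw [← Real.exp_nat_mul]
  ring_nf

theorem exists_dist_le_of_flow_along_curve (hE : ProperLSC E)
    (hv : ∀ t ∈ uIcc a b, IsEVIFlowFrom E lam (v t) (γ t)) (hγ : ContinuousOn γ (uIcc a b))
    (hh : ContinuousOn h (uIcc a b)) (hpos : ∀ t ∈ uIcc a b, 0 < h t) :
    ∃ c T L : ℝ, 0 < c ∧ (∀ t ∈ uIcc a b, h t ∈ Ico c T) ∧
      ∀ t ∈ uIcc a b, ∀ r ∈ Icc c T, ∀ q ∈ Icc c T, dist (v t r) (v t q) ≤ L * |r - q| := by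
  obtain ⟨p, hp, hmin⟩ := isCompact_uIcc.exists_isMinOn nonempty_uIcc hh
  obtain ⟨q, hq, hmax⟩ := isCompact_uIcc.exists_isMaxOn nonempty_uIcc hh
  obtain ⟨L, hL⟩ := IsEVIFlowFrom.exists_forall_dist_le hE lam
    (isCompact_uIcc.image_of_continuousOn hγ).isBounded (hpos p hp)
    ((hpos q hq).trans (lt_add_one _))
  exact ⟨h p, h q + 1, L, hpos p hp, fun t ht => ⟨hmin ht, (hmax ht).trans_lt (lt_add_one _)⟩,
    fun t ht => hL _ (mem_image_of_mem γ ht) _ (hv t ht)⟩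

theorem absolutelyContinuousOnInterval_flow_along_curve (hE : ProperLSC E)
    (hv : ∀ t ∈ uIcc a b, IsEVIFlowFrom E lam (v t) (γ t))
    (hγ : AbsolutelyContinuousOnInterval γ a b) (hh : AbsolutelyContinuousOnInterval h a b)
    (hpos : ∀ t ∈ uIcc a b, 0 < h t) :
    AbsolutelyContinuousOnInterval (fun t => v t (h t)) a b := by
  obtain ⟨c, T, L, -, hmem, hL⟩ := exists_dist_le_of_flow_along_curve hE hv
    (continuousOn_of_absolutelyContinuousOnInterval hγ) hh.continuousOn hpos
  refine absolutelyContinuousOnInterval_of_dist_le (Real.exp (|lam| * T)) L hγ hh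
    fun s hs t ht => (dist_triangle _ (v t (h s)) _).trans (add_le_add ?_ ?_)
  · refine ((hv s hs).dist_le (hv t ht) hE (hpos s hs)).trans ?_
    refine mul_le_mul_of_nonneg_right ?_ dist_nonneg
    rw [← neg_mul, ← abs_neg lam]
    exact exp_mul_le_exp_abs_mul (hpos s hs).le (hmem s hs).2.le
  · exact hL t ht _ (Ico_subset_Icc_self (hmem s hs)) _ (Ico_subset_Icc_self (hmem t ht))

theorem absolutelyContinuousOnInterval_toReal_flow_along_curve (hE : ProperLSC E)
    (hv : ∀ t ∈ uIcc a b, IsEVIFlowFrom E lam (v t) (γ t))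
    (hγ : AbsolutelyContinuousOnInterval γ a b) (hh : AbsolutelyContinuousOnInterval h a b)
    (hpos : ∀ t ∈ uIcc a b, 0 < h t) :
    AbsolutelyContinuousOnInterval (fun t => (E (v t (h t))).toReal) a b := by
  obtain ⟨c, T, L, hc, hmem, hL⟩ := exists_dist_le_of_flow_along_curve hE hv
    (continuousOn_of_absolutelyContinuousOnInterval hγ) hh.continuousOn hpos
  exact absolutelyContinuousOnInterval_toReal_of_globalSlopeLE hE
    (absolutelyContinuousOnInterval_flow_along_curve hE hv hγ hh hpos)
    (fun t ht => (hv t ht).flow.ne_top hE (hpos t ht))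
    fun t ht => (hv t ht).flow.globalSlopeLE_of_dist_le hE hc (hL t ht) (hmem t ht)

theorem eventually_energy_dissipation (hE : ProperLSC E)
    (hv : ∀ᶠ s in 𝓝 t, IsEVIFlowFrom E lam (v s) (γ s)) (hγ : ContinuousAt γ t)
    (hh : ContinuousAt h t) (hpos : 0 < h t) {c : ℝ} (hc : 0 ≤ c)
    (hslope : ENNReal.ofReal c < descendingSlope E (v t (h t))) :
    ∀ᶠ s in 𝓝 t, ∀ r ∈ Ioo (h t) (h s),
      (E (v s (h s))).toReal + c ^ 2 * (h s - r) ≤ (E (v s r)).toReal := by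
  have hvt := hv.self_of_nhds
  obtain ⟨P, hP, Q, hQ, hPQ⟩ := eventually_prod_iff.1
    ((hvt.tendsto_of_tendsto_start hE hv hγ hpos).eventually
      (eventually_not_globalSlopeLE hE (hvt.flow.ne_top hE hpos) hslope lam))
  obtain ⟨η, hη, hIco⟩ := mem_nhdsGE_iff_exists_Ico_subset.1 (mem_nhdsWithin_of_mem_nhds hQ)
  filter_upwards [hP, hv, hh.eventually (gt_mem_nhds hη)] with s hPs hvs hsη r hr
  exact hvs.flow.energy_dissipation hE (hpos.trans hr.1) hr.2.le hc fun q hq =>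
    hPQ hPs (hIco ⟨(hr.1.trans hq.1).le, hq.2.trans hsη⟩)

theorem IsEVIFlowFrom.dist_sq_le_of_energy_dissipation {u w : ℝ → X} {x y : X}
    (hu : IsEVIFlowFrom E lam u x) (hw : IsEVIFlowFrom E lam w y) (hE : ProperLSC E) {κ : ℝ}
    (ha : 0 < a) (hab : a ≤ b) (hκ : 0 ≤ κ)
    (hdiss : ∀ r ∈ Ioo a b, (E (u b)).toReal + κ * (b - r) ≤ (E (u r)).toReal) :
    Real.exp (lam * (b - a)) / 2 * dist (u b) (w a) ^ 2 -
        1 / 2 * Real.exp (-2 * lam * a) * dist x y ^ 2 ≤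
      ((E (w a)).toReal - (E (u b)).toReal) * expIntegral lam (b - a) -
        κ * Real.exp (-(|lam| * (b - a))) * (b - a) ^ 2 / 2 := by
  have hevi := (hu.flow.integral_evi_toReal hE ha hab (hw.flow.ne_top hE ha)
    (g := fun r => (E (w a)).toReal - (E (u b)).toReal - κ * (b - r)) (by fun_prop)
    fun r hr => by linarith [hdiss r hr]).trans (integral_exp_mul_sub_mul_sub_le hab hκ)
  have hcontr : dist (u a) (w a) ^ 2 ≤ Real.exp (-2 * lam * a) * dist x y ^ 2 := by
    rw [← exp_neg_mul_sq, ← mul_pow]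
    exact pow_le_pow_left₀ dist_nonneg (hu.dist_le hw hE ha) 2
  linarith

theorem metricSpeed_ineq_of_energy_dissipation (hE : ProperLSC E)
    (hv : ∀ᶠ s in 𝓝 t, IsEVIFlowFrom E lam (v s) (γ s)) (hpos : 0 < h t) {p w dh dE κ : ℝ}
    (hp : HasMetricSpeedAt γ p t) (hw : HasMetricSpeedAt (fun s => v s (h s)) w t)
    (hdh : HasDerivAt h dh t) (hdE : HasDerivAt (fun s => (E (v s (h s))).toReal) dE t)
    {l : Filter ℝ} [l.NeBot] (hl : l ≤ 𝓝[≠] t) (hlt : ∀ᶠ s in l, h t < h s) (hκ : 0 ≤ κ)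
    (hdiss : ∀ᶠ s in l, ∀ r ∈ Ioo (h t) (h s),
      (E (v s (h s))).toReal + κ * (h s - r) ≤ (E (v s r)).toReal) :
    1 / 2 * w ^ 2 + 1 / 2 * dh ^ 2 * κ + dh * dE ≤ 1 / 2 * Real.exp (-2 * lam * h t) * p ^ 2 := by
  have hln : l ≤ 𝓝 t := hl.trans nhdsWithin_le_nhds
  have hh := (hasDerivAt_iff_tendsto_slope.1 hdh).mono_left hl
  have hEnergy := (hasDerivAt_iff_tendsto_slope.1 hdE).mono_left hl
  have hI : HasDerivAt (fun s => expIntegral lam (h s - h t)) dh t := by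
    have hderiv := HasDerivAt.comp (h₂ := expIntegral lam) t
      (hasDerivAt_expIntegral lam (h t - h t)) (hdh.sub_const (h t))
    rwa [sub_self, mul_zero, Real.exp_zero, one_mul] at hderiv
  have hI := (hasDerivAt_iff_tendsto_slope.1 hI).mono_left hl
  have hexp : ∀ μ : ℝ, Tendsto (fun s => Real.exp (μ * (h s - h t))) l (𝓝 1) := fun μ => by
    have hcont : ContinuousAt (fun s => Real.exp (μ * (h s - h t))) t :=
      ((hdh.continuousAt.sub_const _).const_mul μ).rexp
    simpa only [sub_self, mul_zero, Real.exp_zero] using hcont.tendsto.mono_left hln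
  have hlim := le_of_tendsto_of_tendsto
    ((((hexp lam).div_const 2).mul ((hw.mono_left hl).pow 2)).sub
      (((hp.mono_left hl).pow 2).const_mul (1 / 2 * Real.exp (-2 * lam * h t))))
    ((hEnergy.neg.mul hI).sub (((hexp (-|lam|)).const_mul κ).mul (hh.pow 2) |>.div_const 2)) ?_
  · linarith
  filter_upwards [hln hv, hlt, hdiss, hl self_mem_nhdsWithin] with s hvs hlts hdisss hst
  have hst : s - t ≠ 0 := sub_ne_zero.2 hst
  have hineq := div_le_div_of_nonneg_right
    (hvs.dist_sq_le_of_energy_dissipation hv.self_of_nhds hE hpos hlts.le hκ hdisss)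
    (sq_nonneg (s - t))
  simp only [slope_def_field, sub_self, expIntegral_zero, sub_zero, div_pow, sq_abs]
  convert hineq using 1 <;> field_simp
  ring

theorem metricSpeed_le_of_hasDerivAt_zero (hE : ProperLSC E)
    (hv : ∀ᶠ s in 𝓝 t, IsEVIFlowFrom E lam (v s) (γ s)) (hpos : 0 < h t) {p w : ℝ}
    (hp : HasMetricSpeedAt γ p t) (hw : HasMetricSpeedAt (fun s => v s (h s)) w t)
    (hdh : HasDerivAt h 0 t) : w ≤ Real.exp (-(lam * h t)) * p := by
  have hvt := hv.self_of_nhds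
  obtain ⟨L, -, hL⟩ := hvt.flow.exists_forall_dist_le hE (half_pos hpos) (2 * h t)
  have hexp : Tendsto (fun s => Real.exp (-(lam * h s))) (𝓝[≠] t) (𝓝 (Real.exp (-(lam * h t)))) :=
    (hdh.continuousAt.const_mul lam).neg.rexp.tendsto.mono_left nhdsWithin_le_nhds
  have hlim := (hexp.mul hp).add ((tendsto_abs_sub_div_abs_sub hdh).const_mul L)
  rw [abs_zero, mul_zero, add_zero] at hlim
  refine le_of_tendsto_of_tendsto hw hlim (nhdsWithin_le_nhds ?_)
  have hIcc : Icc (h t / 2) (2 * h t) ∈ 𝓝 (h t) := Icc_mem_nhds (by linarith) (by linarith)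
  filter_upwards [hv, hdh.continuousAt.eventually_mem hIcc] with s hvs hs
  rw [← mul_div_assoc, ← mul_div_assoc, ← add_div]
  gcongr
  refine (dist_triangle _ (v t (h s)) _).trans (add_le_add ?_ ?_)
  · exact hvs.dist_le hvt hE ((half_pos hpos).trans_le hs.1)
  · exact hL _ hs _ (mem_of_mem_nhds hIcc)

theorem exists_neBot_le_eventually_lt_of_hasDerivAt_ne_zero {d : ℝ} (hd : HasDerivAt h d t)
    (hd0 : d ≠ 0) : ∃ l : Filter ℝ, l.NeBot ∧ l ≤ 𝓝[≠] t ∧ ∀ᶠ s in l, h t < h s := by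
  have hslope := hasDerivAt_iff_tendsto_slope.1 hd
  rcases lt_or_gt_of_ne hd0 with hneg | hpos
  · refine ⟨𝓝[<] t, inferInstance, nhdsLT_le_nhdsNE t, ?_⟩
    filter_upwards [(hslope.mono_left (nhdsLT_le_nhdsNE t)).eventually (gt_mem_nhds hneg),
      self_mem_nhdsWithin] with s hs hst
    rw [slope_def_field, div_lt_iff_of_neg (sub_neg.2 hst), zero_mul] at hs
    exact sub_pos.1 hs
  · refine ⟨𝓝[>] t, inferInstance, nhdsGT_le_nhdsNE t, ?_⟩
    filter_upwards [(hslope.mono_left (nhdsGT_le_nhdsNE t)).eventually (lt_mem_nhds hpos),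
      self_mem_nhdsWithin] with s hs hst
    rw [slope_def_field, lt_div_iff₀ (sub_pos.2 hst), zero_mul] at hs
    exact sub_pos.1 hs

theorem metricSpeed_ineq_of_ne_zero (hE : ProperLSC E)
    (hv : ∀ᶠ s in 𝓝 t, IsEVIFlowFrom E lam (v s) (γ s)) (hγ : ContinuousAt γ t) (hpos : 0 < h t)
    {p w dh dE : ℝ} (hp : HasMetricSpeedAt γ p t) (hw : HasMetricSpeedAt (fun s => v s (h s)) w t)
    (hdh : HasDerivAt h dh t) (hdE : HasDerivAt (fun s => (E (v s (h s))).toReal) dE t)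
    (hdh0 : dh ≠ 0) :
    1 / 2 * w ^ 2 + 1 / 2 * dh ^ 2 * (descendingSlope E (v t (h t))).toReal ^ 2 + dh * dE ≤
      1 / 2 * Real.exp (-2 * lam * h t) * p ^ 2 := by
  obtain ⟨l, _, hl, hlt⟩ := exists_neBot_le_eventually_lt_of_hasDerivAt_ne_zero hdh hdh0
  have hln : l ≤ 𝓝 t := hl.trans nhdsWithin_le_nhds
  set σ := (descendingSlope E (v t (h t))).toReal
  have hσ0 : 0 ≤ σ := ENNReal.toReal_nonneg
  rcases hσ0.eq_or_lt with hσ | hσ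
  · rw [← hσ]
    refine metricSpeed_ineq_of_energy_dissipation hE hv hpos hp hw hdh hdE hl hlt (sq_nonneg 0) ?_
    filter_upwards [hln hv] with s hvs r hr
    have hr0 : 0 < r := hpos.trans hr.1
    simpa only [zero_pow two_ne_zero, zero_mul, add_zero] using
      hvs.flow.antitoneOn_toReal hE hr0 (hr0.trans hr.2) hr.2.le
  · have hlim : Tendsto (fun c => 1 / 2 * w ^ 2 + 1 / 2 * dh ^ 2 * c ^ 2 + dh * dE) (𝓝[<] σ)
        (𝓝 (1 / 2 * w ^ 2 + 1 / 2 * dh ^ 2 * σ ^ 2 + dh * dE)) := by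
      have hcont : Continuous fun c => 1 / 2 * w ^ 2 + 1 / 2 * dh ^ 2 * c ^ 2 + dh * dE := by
        fun_prop
      exact (hcont.tendsto σ).mono_left nhdsWithin_le_nhds
    refine le_of_tendsto hlim ?_
    filter_upwards [Ioo_mem_nhdsLT hσ] with c hc
    have hslope : ENNReal.ofReal c < descendingSlope E (v t (h t)) :=
      (ENNReal.ofReal_lt_iff_lt_toReal hc.1.le
        (hv.self_of_nhds.flow.descendingSlope_ne_top hE hpos)).2 hc.2
    exact metricSpeed_ineq_of_energy_dissipation hE hv hpos hp hw hdh hdE hl hlt (sq_nonneg c)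
      (hln (eventually_energy_dissipation hE hv hγ hdh.continuousAt hpos hc.1.le hslope))

theorem metricSpeed_ineq (hE : ProperLSC E)
    (hv : ∀ᶠ s in 𝓝 t, IsEVIFlowFrom E lam (v s) (γ s)) (hγ : ContinuousAt γ t) (hpos : 0 < h t)
    {p w dh dE : ℝ} (hp : HasMetricSpeedAt γ p t) (hw : HasMetricSpeedAt (fun s => v s (h s)) w t)
    (hdh : HasDerivAt h dh t) (hdE : HasDerivAt (fun s => (E (v s (h s))).toReal) dE t) :
    1 / 2 * w ^ 2 + 1 / 2 * dh ^ 2 * (descendingSlope E (v t (h t))).toReal ^ 2 + dh * dE ≤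
      1 / 2 * Real.exp (-2 * lam * h t) * p ^ 2 := by
  rcases ne_or_eq dh 0 with hdh0 | rfl
  · exact metricSpeed_ineq_of_ne_zero hE hv hγ hpos hp hw hdh hdE hdh0
  have hw0 : 0 ≤ w := ge_of_tendsto hw (Eventually.of_forall fun s => by positivity)
  have hsq := pow_le_pow_left₀ hw0 (metricSpeed_le_of_hasDerivAt_zero hE hv hpos hp hw hdh) 2
  rw [mul_pow, exp_neg_mul_sq] at hsq
  linarith

theorem ae_metricSpeed_ineq (hE : ProperLSC E)
    (hv : ∀ t ∈ Ioo a b, IsEVIFlowFrom E lam (v t) (γ t))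
    (hγ : AbsolutelyContinuousOnInterval γ a b) (hh : AbsolutelyContinuousOnInterval h a b)
    (hpos : ∀ t ∈ Ioo a b, 0 < h t) :
    ∀ᵐ t, t ∈ Ioo a b → ∃ p w dh dE : ℝ, HasMetricSpeedAt γ p t ∧
      HasMetricSpeedAt (fun s => v s (h s)) w t ∧ HasDerivAt h dh t ∧
      HasDerivAt (fun s => (E (v s (h s))).toReal) dE t ∧
      1 / 2 * w ^ 2 + 1 / 2 * dh ^ 2 * (descendingSlope E (v t (h t))).toReal ^ 2 + dh * dE ≤
        1 / 2 * Real.exp (-2 * lam * h t) * p ^ 2 := by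
  refine ae_mem_Ioo_of_forall_compact_subinterval fun c d hac hcd hdb => ?_
  have hsub : uIcc c d ⊆ Ioo a b := by
    rw [uIcc_of_le hcd.le]
    exact Icc_subset_Ioo hac hdb
  have hsub' : uIcc c d ⊆ uIcc a b := hsub.trans (Ioo_subset_Icc_self.trans Icc_subset_uIcc)
  have hvcd : ∀ t ∈ uIcc c d, IsEVIFlowFrom E lam (v t) (γ t) := fun t ht => hv t (hsub ht)
  have hposcd : ∀ t ∈ uIcc c d, 0 < h t := fun t ht => hpos t (hsub ht)
  have hγcd := hγ.mono hsub'
  have hhcd := hh.mono hsub'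
  filter_upwards [ae_exists_hasMetricSpeedAt hcd.le hγcd,
    ae_exists_hasMetricSpeedAt hcd.le
      (absolutelyContinuousOnInterval_flow_along_curve hE hvcd hγcd hhcd hposcd),
    hhcd.ae_differentiableAt,
    (absolutelyContinuousOnInterval_toReal_flow_along_curve hE hvcd hγcd hhcd
      hposcd).ae_differentiableAt] with t hp hw hdh hdE ht
  have hnhds : uIcc c d ∈ 𝓝 t := uIcc_of_le hcd.le ▸ Icc_mem_nhds ht.1 ht.2
  have htcd : t ∈ uIcc c d := mem_of_mem_nhds hnhds
  obtain ⟨p, hp⟩ := hp ht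
  obtain ⟨w, hw⟩ := hw ht
  refine ⟨p, w, _, _, hp, hw, (hdh htcd).hasDerivAt, (hdE htcd).hasDerivAt, ?_⟩
  exact metricSpeed_ineq hE (eventually_of_mem hnhds hvcd)
    ((continuousOn_of_absolutelyContinuousOnInterval hγcd).continuousAt hnhds) (hposcd t htcd)
    hp hw (hdh htcd).hasDerivAt (hdE htcd).hasDerivAt

end RegularizedCurve

theorem HasMetricSpeedAt.congr_of_eventuallyEq {X : Type*} [MetricSpace X] {γ η : ℝ → X} {v t : ℝ}
    (hη : HasMetricSpeedAt η v t) (hγη : γ =ᶠ[𝓝 t] η) : HasMetricSpeedAt γ v t := by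
  refine Tendsto.congr' ?_ hη
  filter_upwards [nhdsWithin_le_nhds hγη] with s hs
  rw [hs, hγη.self_of_nhds]

theorem proposition3p7_general {X : Type*} [MetricSpace X] {E : X → EReal} {lam a b : ℝ}
    {γ γtilde : ℝ → X} {h : ℝ → ℝ} (hE : ProperLSC E)
    (hflow : ∀ t ∈ Ioo a b, ∃ u, IsEVIFlowFrom E lam u (γ t))
    (hγ : AbsolutelyContinuousOnInterval γ a b) (hh : AbsolutelyContinuousOnInterval h a b)
    (hpos : ∀ t ∈ Ioo a b, 0 < h t)
    (hγtilde : ∀ t ∈ Ioo a b, γtilde t = eviSemigroup E lam (h t) (γ t)) :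
    (∀ t ∈ Ioo a b, E (γtilde t) ≠ ⊤ ∧ descendingSlope E (γtilde t) ≠ ⊤) ∧
    ∀ᵐ t : ℝ, t ∈ Ioo a b →
      ∃ speed speedTilde dh dE : ℝ,
        HasMetricSpeedAt γ speed t ∧
        HasMetricSpeedAt γtilde speedTilde t ∧
        HasDerivAt h dh t ∧
        HasDerivAt (fun s => (E (γtilde s)).toReal) dE t ∧
        1 / 2 * speedTilde ^ 2 + 1 / 2 * |dh| ^ 2 * (descendingSlope E (γtilde t)).toReal ^ 2 +
            dh * dE ≤ 1 / 2 * Real.exp (-2 * lam * h t) * speed ^ 2 := by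
  have : Nonempty X := ⟨γ a⟩
  choose! v hv using hflow
  have hΓ : EqOn γtilde (fun t => v t (h t)) (Ioo a b) := fun t ht =>
    (hγtilde t ht).trans ((hv t ht).eviSemigroup_eq hE (hpos t ht))
  refine ⟨fun t ht => ?_, ?_⟩
  · rw [hΓ ht]
    exact ⟨(hv t ht).flow.ne_top hE (hpos t ht),
      (hv t ht).flow.descendingSlope_ne_top hE (hpos t ht)⟩
  filter_upwards [ae_metricSpeed_ineq hE hv hγ hh hpos] with t hineq ht
  obtain ⟨p, w, dh, dE, hp, hw, hdh, hdE, hle⟩ := hineq ht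
  have hΓt : γtilde =ᶠ[𝓝 t] fun s => v s (h s) := hΓ.eventuallyEq_of_mem (Ioo_mem_nhds ht.1 ht.2)
  refine ⟨p, w, dh, dE, hp, hw.congr_of_eventuallyEq hΓt, hdh, ?_, ?_⟩
  · exact hdE.congr_of_eventuallyEq (hΓt.fun_comp fun x => (E x).toReal)
  · rwa [hΓ ht, sq_abs]

theorem proposition3p7 {X : Type*} [MetricSpace X] [CompleteSpace X]
    [TopologicalSpace.SeparableSpace X] (E : X → EReal) (lam : ℝ) (hE : EVISetting E lam)
    (γ : ℝ → X) (hγ : AbsolutelyContinuousOnInterval γ 0 1)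
    (h : ℝ → ℝ) (hh : AbsolutelyContinuousOnInterval h 0 1)
    (hpos : ∀ t ∈ Ioo (0 : ℝ) 1, 0 < h t)
    (γtilde : ℝ → X) (hγtilde : ∀ t ∈ Icc (0 : ℝ) 1, γtilde t = eviSemigroup E lam (h t) (γ t)) :
    (∀ t ∈ Ioo (0 : ℝ) 1, E (γtilde t) ≠ ⊤ ∧ descendingSlope E (γtilde t) ≠ ⊤) ∧
    ∀ᵐ t : ℝ, t ∈ Ioo (0 : ℝ) 1 →
      ∃ speed speedTilde dh dE : ℝ,
        HasMetricSpeedAt γ speed t ∧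
        HasMetricSpeedAt γtilde speedTilde t ∧
        HasDerivAt h dh t ∧
        HasDerivAt (fun s => (E (γtilde s)).toReal) dE t ∧
        1 / 2 * speedTilde ^ 2 + 1 / 2 * |dh| ^ 2 * (descendingSlope E (γtilde t)).toReal ^ 2 + dh * dE
          ≤ 1 / 2 * Real.exp (-2 * lam * h t) * speed ^ 2 := by
  exact proposition3p7_general ⟨hE.ne_bot, hE.lsc, hE.dense_domain.nonempty_iff.2 ⟨γ 0⟩⟩
    (fun t _ => hE.exists_flow (γ t)) hγ hh hpos fun t ht => hγtilde t (Ioo_subset_Icc_self ht)
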